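/- Let $\hbar>0$. For $N$ bosonic modes with Hilbert space $L^2(\mathbb R^N)$, canonical operators $Q_j$ (multiplication by $q_j$) and $P_j=-i\hbar\,\partial_{q_j}$, and phase-space vectors written in the order $\vec v=(x_1,p_1,\dots,x_N,p_N)\in\mathbb R^{2N}$, let $$D_{\vec v}=\bigotimes_{j=1}^N\exp\!\Big(\tfrac{i}{\hbar}(p_jQ_j-x_jP_j)\Big)$$ be the displacement by $\vec v$, and let $\Omega_N=\bigoplus_{j=1}^N\begin{bmatrix}0&1\\-1&0\end{bmatrix}$. A density operator $\rho$ is Gaussian with mean $\mu\in\mathbb R^{2N}$ and (real symmetric) covariance matrix $\Sigma\in\mathbb R^{2N\times 2N}$ if, for all $\vec v\in\mathbb R^{2N}$, $\mathrm{tr}(\rho D_{\vec v})=\exp\!\big(-\tfrac1{2\hbar^2}(\Omega_N\vec v)^{T}\Sigma(\Omega_N\vec v)+\tfrac i\hbar(\Omega_N\vec v)^{T}\mu\big)$. **Proposition.** Let $\rho$ be a Gaussian density operator over $m+n$ modes with covariance matrix $\Sigma$, and let $\vec v\in\mathbb R^{2m}$. Consider the semidefinite program $$\begin{aligned} &\text{maximize}\quad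 \frac{1}{\pi\hbar^2}(\Omega_m\vec v)^{T}Z\,(\Omega_m\vec v)\\ &\text{s.t.}\quad Z\ \ge\ i\tfrac{\hbar}{2}\Omega_m,\\ &\qquad\ \ \Sigma-\begin{bmatrix}0&0\\0&i\frac{\hbar}{2}\Omega_n\end{bmatrix}\ \ge\ \begin{bmatrix}Z&0\\0&0\end{bmatrix},\\ &\qquad\ \ Z\in\mathrm{Herm}(\mathbb C^{2m\times 2m}). \end{aligned}$$ Its maximum $s$ exists, and for every $m$-mode density operator $\tilde\rho$ that can be obtained from $\rho$ by a (possibly non-Gaussian) post-selection on the last $n$ modes succeeding with non-zero probability (that is, $p\,\tilde\rho=\mathrm{tr}_n[\rho\,(\mathbb 1\otimes E)]$ for some operator $0\le E\le \mathbb 1$ on the last $n$ modes and some $p>0$, where $\mathrm{tr}_n$ is the partial trace over the last $n$ modes), $$|\mathrm{tr}(\tilde\rho\,D_{\vec v})|\ \le\ \exp\!\Big(-\frac{\pi}{2}\,s\Big).$$ Moreover, if $Z$ is any feasible point of the program in which $\Omega_n$ is replaced by $-\Omega_n$ (this program may be infeasible), then likewise $|\mathrm{tr}(\tilde\rho D_{\vec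 v})|\le\exp\!\big(-\tfrac{1}{2\hbar^2}(\Omega_m\vec v)^{T}Z(\Omega_m\vec v)\big)$ for every such $\tilde\rho$. -/

import Mathlib

open MeasureTheory Matrix
open scoped ENNReal ComplexOrder

noncomputable section

namespace BosonicModes

/-- The Hilbert space `L²(ℝ^ι)` of a family of bosonic modes labelled by the finite set `ι`
(Schrödinger representation, `ψ` is a function of the position coordinates). -/
abbrev ModeSpace (ι : Type) [Fintype ι] : Type :=
  Lp ℂ 2 (volume : Measure (ι → ℝ))

/-- Indices of the phase space `ℝ^{2N}` of the modes `ι`: the coordinate `(j, 0)` is the position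
of mode `j` and `(j, 1)` its momentum (the ordering `x₁, p₁, x₂, p₂, …`). -/
abbrev Quad (ι : Type) : Type := ι × Fin 2

/-! ### Displacement operators -/

theorem memLp_displacement {ι : Type} [Fintype ι] (ħ : ℝ) (v : Quad ι → ℝ) (ψ : ModeSpace ι) :
    MemLp (fun q : ι → ℝ =>
      Complex.exp (Complex.I * ((∑ j, v (j, 1) * (q j - v (j, 0) / 2) : ℝ) : ℂ) / (ħ : ℂ)) *
        ψ (q - fun j => v (j, 0))) 2 volume := by
  have h : MemLp (fun q : ι → ℝ => ψ (q - fun j => v (j, 0))) 2 volume :=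
    (Lp.memLp ψ).comp_measurePreserving (measurePreserving_sub_right volume _)
  have hc : Continuous (fun q : ι → ℝ =>
      Complex.exp (Complex.I * ((∑ j, v (j, 1) * (q j - v (j, 0) / 2) : ℝ) : ℂ) / (ħ : ℂ))) := by
    fun_prop
  refine h.of_le (hc.aestronglyMeasurable.mul h.1) (Filter.Eventually.of_forall fun q => ?_)
  have e : Complex.I * ((∑ j, v (j, 1) * (q j - v (j, 0) / 2) : ℝ) : ℂ) / (ħ : ℂ) =
      (((∑ j, v (j, 1) * (q j - v (j, 0) / 2)) / ħ : ℝ) : ℂ) * Complex.I := by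
    push_cast; ring
  rw [norm_mul, e, Complex.norm_exp_ofReal_mul_I, one_mul]

/-- The displacement (Weyl) operator
`D_v = ⨂ⱼ exp((i/ħ)(pⱼ Qⱼ - xⱼ Pⱼ))`, `v = (x₁, p₁, x₂, p₂, …)`, with `Qⱼ` multiplication by the
`j`-th coordinate and `Pⱼ = -iħ ∂ⱼ`. It shifts phase space by `v`, and it acts by
`(D_v ψ)(q) = exp((i/ħ) ∑ⱼ pⱼ (qⱼ - xⱼ/2)) ψ(q - x)`. -/
def displacement {ι : Type} [Fintype ι] (ħ : ℝ) (v : Quad ι → ℝ) :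
    ModeSpace ι →L[ℂ] ModeSpace ι :=
  LinearMap.mkContinuous
    { toFun := fun ψ => (memLp_displacement ħ v ψ).toLp _
      map_add' := fun ψ φ => by
        rw [← MemLp.toLp_add, MemLp.toLp_eq_toLp_iff]
        have h := (measurePreserving_sub_right (volume : Measure (ι → ℝ))
          (fun j => v (j, 0))).quasiMeasurePreserving.ae_eq_comp (Lp.coeFn_add ψ φ)
        filter_upwards [h] with q hq
        simp only [Function.comp_apply, Pi.add_apply] at hq ⊢
        rw [hq, mul_add]
      map_smul' := fun c ψ => by
        rw [RingHom.id_apply, ← MemLp.toLp_const_smul, MemLp.toLp_eq_toLp_iff]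
        have h := (measurePreserving_sub_right (volume : Measure (ι → ℝ))
          (fun j => v (j, 0))).quasiMeasurePreserving.ae_eq_comp (Lp.coeFn_smul c ψ)
        filter_upwards [h] with q hq
        simp only [Function.comp_apply, Pi.smul_apply, smul_eq_mul] at hq ⊢
        rw [hq]; ring }
    1 (fun ψ => by
      have h : MemLp (fun q : ι → ℝ => ψ (q - fun j => v (j, 0))) 2 volume :=
        (Lp.memLp ψ).comp_measurePreserving (measurePreserving_sub_right volume _)
      have hn : ‖h.toLp _‖ = ‖ψ‖ := by
        rw [Lp.norm_toLp, Lp.norm_def]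
        congr 1
        exact eLpNorm_comp_measurePreserving (Lp.aestronglyMeasurable ψ)
          (measurePreserving_sub_right volume _)
      rw [one_mul, ← hn]
      change ‖(memLp_displacement ħ v ψ).toLp _‖ ≤ _
      rw [Lp.norm_toLp, Lp.norm_toLp]
      refine ENNReal.toReal_mono h.2.ne (eLpNorm_mono fun q => ?_)
      have e : Complex.I * ((∑ j, v (j, 1) * (q j - v (j, 0) / 2) : ℝ) : ℂ) / (ħ : ℂ) =
          (((∑ j, v (j, 1) * (q j - v (j, 0) / 2)) / ħ : ℝ) : ℂ) * Complex.I := by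
        push_cast; ring
      rw [norm_mul, e, Complex.norm_exp_ofReal_mul_I, one_mul])

/-! ### Traces, density operators, product vectors -/

/-- `T` has trace `t`: in every orthonormal basis the diagonal matrix elements of `T` are
summable with sum `t` (for a bounded operator this says that `T` is trace class with trace `t`). -/
def HasTrace {H : Type} [NormedAddCommGroup H] [InnerProductSpace ℂ H]
    (T : H →L[ℂ] H) (t : ℂ) : Prop :=
  ∀ (K : Type) (b : HilbertBasis K ℂ H), HasSum (fun k => inner ℂ (b k) (T (b k))) t

/-- A density operator: positive, of trace one. -/
def IsDensityOperator {H : Type} [NormedAddCommGroup H] [InnerProductSpace ℂ H]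
    (ρ : H →L[ℂ] H) : Prop :=
  ρ.IsPositive ∧ HasTrace ρ 1

theorem memLp_productVector {ι κ : Type} [Fintype ι] [Fintype κ]
    (φ : ModeSpace ι) (χ : ModeSpace κ) :
    MemLp (fun q : ι ⊕ κ → ℝ => φ (fun i => q (Sum.inl i)) * χ (fun k => q (Sum.inr k)))
      2 volume := by
  have hp : MemLp (fun z : (ι → ℝ) × (κ → ℝ) => φ z.1 * χ z.2) 2 (volume.prod volume) := by
    have hm : AEStronglyMeasurable (fun z : (ι → ℝ) × (κ → ℝ) => φ z.1 * χ z.2)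
        (volume.prod volume) :=
      ((Lp.aestronglyMeasurable φ).comp_fst).mul ((Lp.aestronglyMeasurable χ).comp_snd)
    rw [memLp_two_iff_integrable_sq_norm hm]
    have h1 := (memLp_two_iff_integrable_sq_norm (Lp.aestronglyMeasurable φ)).1 (Lp.memLp φ)
    have h2 := (memLp_two_iff_integrable_sq_norm (Lp.aestronglyMeasurable χ)).1 (Lp.memLp χ)
    refine (h1.mul_prod h2).congr (Filter.Eventually.of_forall fun z => ?_)
    simp only [norm_mul, mul_pow]
  exact hp.comp_measurePreserving (volume_measurePreserving_sumPiEquivProdPi (fun _ : ι ⊕ κ => ℝ))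

/-- The product vector `φ ⊗ χ` in `L²(ℝ^{ι ⊕ κ}) = L²(ℝ^ι) ⊗ L²(ℝ^κ)`. -/
def productVector {ι κ : Type} [Fintype ι] [Fintype κ]
    (φ : ModeSpace ι) (χ : ModeSpace κ) : ModeSpace (ι ⊕ κ) :=
  (memLp_productVector φ χ).toLp _

/-! ### Gaussian states and post-selection -/

/-- The symplectic form `Ω_N = ⨁ Ω₁`, `Ω₁ = [[0, 1], [-1, 0]]`, in the ordering
`x₁, p₁, x₂, p₂, …`. -/
def symplecticForm (ι : Type) [DecidableEq ι] : Matrix (Quad ι) (Quad ι) ℝ :=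
  Matrix.kroneckerMap (· * ·) (1 : Matrix ι ι ℝ) !![0, 1; -1, 0]

/-- `ρ` is a Gaussian density operator with mean vector `μ` and covariance matrix `Σ`: its
characteristic function is
`tr(ρ D_v) = exp(-(1/(2ħ²)) (Ωv)ᵀ Σ (Ωv) + (i/ħ) (Ωv)ᵀ μ)` for all `v` in phase space.
(Here `D_v = exp((i/ħ) (Ωv)ᵀ R)` with `R = (Q₁, P₁, Q₂, P₂, …)`.) -/
def IsGaussianState {ι : Type} [Fintype ι] [DecidableEq ι] (ħ : ℝ)
    (ρ : ModeSpace ι →L[ℂ] ModeSpace ι) (μ : Quad ι → ℝ)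
    (cov : Matrix (Quad ι) (Quad ι) ℝ) : Prop :=
  IsDensityOperator ρ ∧ cov.IsSymm ∧
    ∀ v : Quad ι → ℝ, HasTrace (ρ ∘L displacement ħ v)
      (Complex.exp
        (-(((symplecticForm ι *ᵥ v) ⬝ᵥ (cov *ᵥ (symplecticForm ι *ᵥ v)) / (2 * ħ ^ 2) : ℝ) : ℂ)
          + Complex.I * ((symplecticForm ι *ᵥ v ⬝ᵥ μ / ħ : ℝ) : ℂ)))

/-- `ρ'` is a state of the modes `ι` obtained from the state `ρ` of the modes `ι ⊕ κ` by
post-selecting, with non-zero probability, on some outcome of some measurement of the modes `κ`: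
there are an effect (POVM element) `0 ≤ E ≤ 1` on the modes `κ` and a probability `p > 0` with
`p ρ' = tr_κ[ρ (1 ⊗ E)]`, the partial trace being evaluated in an arbitrary orthonormal basis of
the modes `κ`. -/
def IsPostselectedState {ι κ : Type} [Fintype ι] [Fintype κ]
    (ρ : ModeSpace (ι ⊕ κ) →L[ℂ] ModeSpace (ι ⊕ κ))
    (ρ' : ModeSpace ι →L[ℂ] ModeSpace ι) : Prop :=
  IsDensityOperator ρ' ∧
    ∃ (E : ModeSpace κ →L[ℂ] ModeSpace κ) (p : ℝ),
      E.IsPositive ∧ (1 - E).IsPositive ∧ 0 < p ∧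
        ∀ (K : Type) (b : HilbertBasis K ℂ (ModeSpace κ)) (φ ψ : ModeSpace ι),
          HasSum (fun k => inner ℂ (productVector φ (b k)) (ρ (productVector ψ (E (b k)))))
            ((p : ℂ) * inner ℂ φ (ρ' ψ))

/-! ### The semidefinite program -/

/-- The block-diagonal matrix `A ⊕ B` on the phase space of the modes `ι ⊕ κ`. -/
def directSum {ι κ : Type} (A : Matrix (Quad ι) (Quad ι) ℂ) (B : Matrix (Quad κ) (Quad κ) ℂ) :
    Matrix (Quad (ι ⊕ κ)) (Quad (ι ⊕ κ)) ℂ :=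
  (Matrix.fromBlocks A 0 0 B).submatrix
    (Equiv.sumProdDistrib ι κ (Fin 2)) (Equiv.sumProdDistrib ι κ (Fin 2))

/-- The complex Hermitian matrix `i (ħ/2) Ω`. -/
def halfOmega (ħ : ℝ) (ι : Type) [DecidableEq ι] : Matrix (Quad ι) (Quad ι) ℂ :=
  (Complex.I * (ħ / 2 : ℝ)) • (symplecticForm ι).map Complex.ofReal

/-- The constraints of the program, `≥` being the Loewner order:
`Z` is Hermitian, `Z ≥ i(ħ/2) Ω` and `Σ - (0 ⊕ ε i(ħ/2) Ω) ≥ Z ⊕ 0`, with a sign `ε`. -/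
def SDPFeasible {ι κ : Type} [DecidableEq ι] [DecidableEq κ] (ħ ε : ℝ)
    (cov : Matrix (Quad (ι ⊕ κ)) (Quad (ι ⊕ κ)) ℝ) (Z : Matrix (Quad ι) (Quad ι) ℂ) : Prop :=
  Z.IsHermitian ∧ (Z - halfOmega ħ ι).PosSemidef ∧
    ((cov.map Complex.ofReal - directSum 0 ((ε : ℂ) • halfOmega ħ κ)) -
      directSum Z 0).PosSemidef

/-- The objective `(1/(π ħ²)) (Ωv)ᵀ Z (Ωv)` (a real number, as `Z` is Hermitian and `Ωv` real). -/
def sdpObjective {ι : Type} [Fintype ι] [DecidableEq ι] (ħ : ℝ) (v : Quad ι → ℝ)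
    (Z : Matrix (Quad ι) (Quad ι) ℂ) : ℝ :=
  1 / (Real.pi * ħ ^ 2) *
    ((fun a => ((symplecticForm ι *ᵥ v) a : ℂ)) ⬝ᵥ
      (Z *ᵥ fun a => ((symplecticForm ι *ᵥ v) a : ℂ))).re

end BosonicModes

end

open BosonicModes

noncomputable section

namespace BosonicModes

/-! ### Injectivity of the Fourier transform on integrable functions -/

/-! Write ρ = ∑ |r_l⟩⟨r_l| and regard R = (r_l) as a single vector of ℓ²(L; H), a purification of ρ.
Then ⟨R, (1 ⊗ D_v) R⟩ is the characteristic function, and all inner products between displaced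
copies of R form an explicit Gaussian kernel (`inner_amplify_displacement`). With F = √E, the
operator p ρ' is the sum of the rank-one operators |x⟩⟨x| over the slices x_{l,k} = (1 ⊗ ⟨F b_k|)
r_l (`isRankOneSum_postselected`). It therefore suffices to bound, for each fixed f = F b_k, the sum
over l of ⟨x_l, D_v x_l⟩ by a constant times ∑ ‖x_l‖² (`norm_tsum_inner_slice_le`).

For fixed f, the slices with a nonzero vector h attached form B = (1 ⊗ |h⟩⟨f|) R. Displacements of
the last n modes act irreducibly there, a consequence of the injectivity of the Fourier transform,
so B is a limit of combinations ∑ c_i D_{0 ⊕ w_i} R (`amplify_rankOneRight_mem_closure`). Thus an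
arbitrary measurement is reduced to finite sums of Gaussian kernels.

For such combinations (`norm_inner_sum_le`), suppose G = Σ + (0 ⊕ i(ħ/2)Ω) - (Z ⊕ 0) is positive
semidefinite. By Schur's product theorem the normalised exponential of G/ħ² is a positive
semidefinite kernel. On the points (∓Ωv/2) ⊕ Ωw_i both of its diagonal blocks, paired with suitable
coefficients, give ‖B‖², while the off-diagonal block has modulus exp((Ωv)ᵀZ(Ωv)/(2ħ²)) |⟨B, D_v
B⟩|. Positivity bounds the latter by ‖B‖².

A feasible point of the program with -Ω_n gives G ≥ 0 as it stands. A feasible Z of the program with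
Ω_n gives it for Zᵀ: transposition fixes Σ and the objective and reverses the sign of iΩ. The
maximum exists because the feasible set is compact and, by the uncertainty relation Σ ≥ i(ħ/2)Ω,
contains i(ħ/2)Ω_m. -/

theorem ae_eq_zero_of_integral_ofReal_mul_exp_eq_zero {V : Type*} [NormedAddCommGroup V]
    [NormedSpace ℝ V] [MeasurableSpace V] [BorelSpace V] [SecondCountableTopology V]
    [CompleteSpace V] {μ : Measure V} {u : V → ℝ} (hu : Integrable u μ)
    (h : ∀ l : StrongDual ℝ V, ∫ x, (u x : ℂ) * Complex.exp (l x * Complex.I) ∂μ = 0) :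
    u =ᵐ[μ] 0 := by
  have hp : IsFiniteMeasure (μ.withDensity fun x => ENNReal.ofReal (u x)) :=
    isFiniteMeasure_withDensity_ofReal hu.2
  have hn : IsFiniteMeasure (μ.withDensity fun x => ENNReal.ofReal (-u x)) :=
    isFiniteMeasure_withDensity_ofReal hu.neg.2
  have mp : AEMeasurable (fun x => ENNReal.ofReal (u x)) μ := hu.1.aemeasurable.ennreal_ofReal
  have mn : AEMeasurable (fun x => ENNReal.ofReal (-u x)) μ := hu.1.aemeasurable.neg.ennreal_ofReal
  -- The positive and negative parts of `u` are densities of two finite measures with the same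
  -- characteristic function, so the measures coincide.
  have key : (μ.withDensity fun x => ENNReal.ofReal (u x)) =
      μ.withDensity fun x => ENNReal.ofReal (-u x) := by
    refine Measure.ext_of_charFunDual (funext fun l => ?_)
    rw [charFunDual_apply, charFunDual_apply,
      integral_withDensity_eq_integral_toReal_smul₀ mp (by simp),
      integral_withDensity_eq_integral_toReal_smul₀ mn (by simp), ← sub_eq_zero]
    have hb : ∀ w : V → ℝ, Integrable w μ → Integrable
        (fun x => (ENNReal.ofReal (w x)).toReal • Complex.exp (l x * Complex.I)) μ := by
      intro w hw
      have hc : Continuous fun x : V => Complex.exp (l x * Complex.I) := by fun_prop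
      have hw' : Integrable (fun x => (ENNReal.ofReal (w x)).toReal) μ := by
        simpa [ENNReal.toReal_ofReal'] using hw.pos_part
      refine hw'.mono (hw'.1.smul hc.aestronglyMeasurable) (.of_forall fun x => ?_)
      rw [norm_smul, Complex.norm_exp_ofReal_mul_I, mul_one]
    rw [← integral_sub (hb u hu) (hb (fun x => -u x) hu.neg), ← h l]
    refine integral_congr_ae (.of_forall fun x => ?_)
    simp only [ENNReal.toReal_ofReal', Complex.real_smul]
    rw [← sub_mul, ← Complex.ofReal_sub]
    congr 2
    rcases le_total 0 (u x) with hx | hx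
    · rw [max_eq_left hx, max_eq_right (by linarith), sub_zero]
    · rw [max_eq_right hx, max_eq_left (by linarith)]; ring
  have hlt : ∫⁻ x, ENNReal.ofReal (u x) ∂μ ≠ ⊤ := by
    have := measure_ne_top (μ.withDensity fun x => ENNReal.ofReal (u x)) Set.univ
    rwa [withDensity_apply _ MeasurableSet.univ, Measure.restrict_univ] at this
  filter_upwards [(withDensity_eq_iff mp mn hlt).1 key] with x hx
  rcases le_total 0 (u x) with h0 | h0
  · rw [ENNReal.ofReal_eq_zero.2 (neg_nonpos.2 h0), ENNReal.ofReal_eq_zero] at hx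
    exact le_antisymm hx h0
  · rw [ENNReal.ofReal_eq_zero.2 h0, eq_comm, ENNReal.ofReal_eq_zero] at hx
    exact le_antisymm h0 (neg_nonpos.1 hx)

/-- Replacing `l` by `-l` and conjugating shows that the conjugate of `f` satisfies the same
hypothesis; hence so do the real and imaginary parts, and the real case applies. -/
theorem ae_eq_zero_of_integral_mul_exp_eq_zero {V : Type*} [NormedAddCommGroup V]
    [NormedSpace ℝ V] [MeasurableSpace V] [BorelSpace V] [SecondCountableTopology V]
    [CompleteSpace V] {μ : Measure V} {f : V → ℂ} (hf : Integrable f μ)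
    (h : ∀ l : StrongDual ℝ V, ∫ x, f x * Complex.exp (l x * Complex.I) ∂μ = 0) :
    f =ᵐ[μ] 0 := by
  have hfe : ∀ (g : V → ℂ), Integrable g μ → ∀ l : StrongDual ℝ V,
      Integrable (fun x => g x * Complex.exp (l x * Complex.I)) μ := by
    intro g hg l
    have hc : Continuous fun x : V => Complex.exp (l x * Complex.I) := by fun_prop
    refine hg.mono (hg.1.mul hc.aestronglyMeasurable) (.of_forall fun x => ?_)
    rw [norm_mul, Complex.norm_exp_ofReal_mul_I, mul_one]
  have hc : Integrable (fun x => (starRingEnd ℂ) (f x)) μ := by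
    refine hf.mono ?_ (.of_forall fun x => by simp)
    exact Complex.continuous_conj.comp_aestronglyMeasurable hf.1
  have h' : ∀ l : StrongDual ℝ V,
      ∫ x, (starRingEnd ℂ) (f x) * Complex.exp (l x * Complex.I) ∂μ = 0 := by
    intro l
    have := congrArg (starRingEnd ℂ) (h (-l))
    rw [← integral_conj, map_zero] at this
    rw [← this]
    refine integral_congr_ae (.of_forall fun x => ?_)
    simp [← Complex.exp_conj]
  have hre : (fun x => (f x).re) =ᵐ[μ] 0 := by
    refine ae_eq_zero_of_integral_ofReal_mul_exp_eq_zero hf.re fun l => ?_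
    have : ∀ x, ((f x).re : ℂ) * Complex.exp (l x * Complex.I) =
        (1 / 2) * (f x * Complex.exp (l x * Complex.I) +
          (starRingEnd ℂ) (f x) * Complex.exp (l x * Complex.I)) := by
      intro x
      rw [← add_mul, Complex.add_conj]; push_cast; ring
    simp_rw [this]
    rw [integral_const_mul, integral_add (hfe _ hf l) (hfe _ hc l), h, h', add_zero, mul_zero]
  have him : (fun x => (f x).im) =ᵐ[μ] 0 := by
    refine ae_eq_zero_of_integral_ofReal_mul_exp_eq_zero hf.im fun l => ?_
    have : ∀ x, ((f x).im : ℂ) * Complex.exp (l x * Complex.I) =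
        (1 / (2 * Complex.I)) * (f x * Complex.exp (l x * Complex.I) -
          (starRingEnd ℂ) (f x) * Complex.exp (l x * Complex.I)) := by
      intro x
      rw [← sub_mul, Complex.sub_conj]; push_cast
      field_simp
    simp_rw [this]
    rw [integral_const_mul, integral_sub (hfe _ hf l) (hfe _ hc l), h, h', sub_zero, mul_zero]
  filter_upwards [hre, him] with x h1 h2
  exact Complex.ext h1 h2

theorem ae_eq_zero_of_integral_exp_sum_mul_eq_zero {ι : Type} [Fintype ι] {ħ : ℝ} (hħ : ħ ≠ 0)
    {f : (ι → ℝ) → ℂ} (hf : Integrable f)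
    (h : ∀ p : ι → ℝ, ∫ q, Complex.exp (Complex.I * ((∑ j, p j * q j : ℝ) : ℂ) / ħ) * f q = 0) :
    f =ᵐ[volume] 0 := by
  classical
  refine ae_eq_zero_of_integral_mul_exp_eq_zero hf fun l => ?_
  -- Every functional on ℝ^ι is a momentum pairing; these are its coordinates, rescaled by ħ.
  rw [← h fun j => ħ * l (Pi.single j 1)]
  refine integral_congr_ae (.of_forall fun q => ?_)
  have e : l q = ∑ j, q j * l (Pi.single j 1) := by
    conv_lhs => rw [pi_eq_sum_univ' q]
    simp [map_sum, Pi.single]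
  simp only
  rw [mul_comm, e]
  congr 2
  push_cast
  rw [Finset.sum_mul, Finset.mul_sum, Finset.sum_div]
  refine Finset.sum_congr rfl fun j _ => ?_
  have : (ħ : ℂ) ≠ 0 := by exact_mod_cast hħ
  field_simp

/-! ### Weyl relations -/

section Displacement

variable {ι : Type} [Fintype ι]

/-- The phase in the Weyl relation `D_v D_w = exp(iθ) D_{v + w}`. -/
def weylPhase (ħ : ℝ) (v w : Quad ι → ℝ) : ℝ :=
  (∑ j, (v (j, 1) * w (j, 0) - v (j, 0) * w (j, 1))) / (2 * ħ)

theorem displacement_ae (ħ : ℝ) (v : Quad ι → ℝ) (ψ : ModeSpace ι) :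
    displacement ħ v ψ =ᵐ[volume] fun q : ι → ℝ =>
      Complex.exp (Complex.I * ((∑ j, v (j, 1) * (q j - v (j, 0) / 2) : ℝ) : ℂ) / (ħ : ℂ)) *
        ψ (q - fun j => v (j, 0)) :=
  (memLp_displacement ħ v ψ).coeFn_toLp

theorem displacement_displacement (ħ : ℝ) (v w : Quad ι → ℝ) (ψ : ModeSpace ι) :
    displacement ħ v (displacement ħ w ψ) =
      Complex.exp (Complex.I * (weylPhase ħ v w : ℂ)) • displacement ħ (v + w) ψ := by
  refine Lp.ext ?_
  have h := (measurePreserving_sub_right (volume : Measure (ι → ℝ))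
    (fun j => v (j, 0))).quasiMeasurePreserving.ae_eq_comp (displacement_ae ħ w ψ)
  filter_upwards [displacement_ae ħ v (displacement ħ w ψ), h, displacement_ae ħ (v + w) ψ,
    Lp.coeFn_smul (Complex.exp (Complex.I * (weylPhase ħ v w : ℂ))) (displacement ħ (v + w) ψ)]
    with q h1 h2 h3 h4
  simp only [Function.comp_apply] at h2
  rw [h1, h2, h4, Pi.smul_apply, h3, smul_eq_mul, ← mul_assoc, ← mul_assoc, ← Complex.exp_add,
    ← Complex.exp_add]
  have e : (q - fun j => v (j, 0)) - (fun j => w (j, 0)) = q - fun j => (v + w) (j, 0) := by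
    ext j; simp [sub_sub]
  rw [e]
  congr 2
  rw [mul_div_assoc, mul_div_assoc, mul_div_assoc, ← mul_add, ← mul_add]
  congr 1
  unfold weylPhase
  norm_cast
  rw [← add_div, mul_comm 2 ħ, ← div_div, div_right_comm, ← add_div]
  congr 1
  rw [Finset.sum_div, ← Finset.sum_add_distrib, ← Finset.sum_add_distrib]
  refine Finset.sum_congr rfl fun j _ => ?_
  simp only [Pi.add_apply, Pi.sub_apply]
  ring

theorem displacement_zero (ħ : ℝ) : displacement ħ (0 : Quad ι → ℝ) = 1 := by
  ext1 ψ
  refine Lp.ext ?_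
  filter_upwards [displacement_ae ħ 0 ψ] with q h
  rw [h, show (q - fun j => (0 : Quad ι → ℝ) (j, 0)) = q by ext; simp]
  simp

theorem weylPhase_neg_self (ħ : ℝ) (v : Quad ι → ℝ) : weylPhase ħ (-v) v = 0 := by
  unfold weylPhase
  rw [Finset.sum_eq_zero, zero_div]
  intro j _
  simp only [Pi.neg_apply]; ring

theorem displacement_neg_self (ħ : ℝ) (v : Quad ι → ℝ) (ψ : ModeSpace ι) :
    displacement ħ (-v) (displacement ħ v ψ) = ψ := by
  rw [displacement_displacement, weylPhase_neg_self, neg_add_cancel, displacement_zero]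
  simp

theorem displacement_self_neg (ħ : ℝ) (v : Quad ι → ℝ) (ψ : ModeSpace ι) :
    displacement ħ v (displacement ħ (-v) ψ) = ψ := by
  conv_lhs => rw [← neg_neg v]
  rw [neg_neg (-v), displacement_neg_self]

theorem norm_displacement_le (ħ : ℝ) (v : Quad ι → ℝ) (ψ : ModeSpace ι) :
    ‖displacement ħ v ψ‖ ≤ ‖ψ‖ := by
  have h := (displacement ħ v).le_of_opNorm_le
    (LinearMap.mkContinuous_norm_le _ zero_le_one _) ψ
  rwa [one_mul] at h

theorem norm_displacement (ħ : ℝ) (v : Quad ι → ℝ) (ψ : ModeSpace ι) :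
    ‖displacement ħ v ψ‖ = ‖ψ‖ := by
  refine le_antisymm (norm_displacement_le ħ v ψ) ?_
  conv_lhs => rw [← displacement_neg_self ħ v ψ]
  exact norm_displacement_le ħ (-v) _

theorem inner_displacement_left (ħ : ℝ) (v : Quad ι → ℝ) (ψ φ : ModeSpace ι) :
    inner ℂ (displacement ħ v ψ) φ = inner ℂ ψ (displacement ħ (-v) φ) := by
  have h := (LinearMap.norm_map_iff_inner_map_map (𝕜 := ℂ) (displacement ħ v)).1
    (norm_displacement ħ v)
  rw [← h ψ, displacement_self_neg]

theorem adjoint_displacement (ħ : ℝ) (v : Quad ι → ℝ) :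
    ContinuousLinearMap.adjoint (displacement ħ v) = displacement ħ (-v) := by
  refine ((ContinuousLinearMap.eq_adjoint_iff _ _).2 fun x y => ?_).symm
  rw [inner_displacement_left, neg_neg]

/-! ### Irreducibility of the displacement operators -/

/-- At a fixed position shift `x`, the matrix element ⟨y, D_{(x,p)} r⟩ is, up to a phase independent
of y and r, the Fourier transform in p of the integrable function q ↦ conj(y(q)) r(q - x). -/
theorem ae_conj_mul_shift_eq_of_inner_displacement_eq {ħ : ℝ} (hħ : ħ ≠ 0)
    {y₁ r₁ y₂ r₂ : ModeSpace ι}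
    (h : ∀ w, inner ℂ y₁ (displacement ħ w r₁) = inner ℂ y₂ (displacement ħ w r₂)) (x : ι → ℝ) :
    ∀ᵐ q : ι → ℝ, (starRingEnd ℂ) (y₁ q) * r₁ (q - x) = (starRingEnd ℂ) (y₂ q) * r₂ (q - x) := by
  have hi : ∀ y r : ModeSpace ι,
      Integrable fun q : ι → ℝ => (starRingEnd ℂ) (y q) * r (q - x) := by
    intro y r
    have h1 : MemLp (fun q : ι → ℝ => r (q - x)) 2 volume :=
      (Lp.memLp r).comp_measurePreserving (measurePreserving_sub_right volume _)
    exact MemLp.integrable_mul (p := 2) (q := 2) (Lp.memLp y).star h1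
  have he : ∀ (p : ι → ℝ) (y r : ModeSpace ι),
      inner ℂ y (displacement ħ (fun a => ![x a.1, p a.1] a.2) r) =
        Complex.exp (-(Complex.I * ((∑ j, p j * (x j / 2) : ℝ) : ℂ) / ħ)) *
        ∫ q, Complex.exp (Complex.I * ((∑ j, p j * q j : ℝ) : ℂ) / ħ) *
          ((starRingEnd ℂ) (y q) * r (q - x)) := by
    intro p y r
    rw [L2.inner_def, ← integral_const_mul]
    refine integral_congr_ae ?_
    filter_upwards [displacement_ae ħ (fun a => ![x a.1, p a.1] a.2) r] with q hq
    rw [hq, RCLike.inner_apply, ← mul_assoc (Complex.exp _) (Complex.exp _), ← Complex.exp_add]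
    have e : -(Complex.I * ((∑ j, p j * (x j / 2) : ℝ) : ℂ) / ħ) +
        Complex.I * ((∑ j, p j * q j : ℝ) : ℂ) / ħ =
        Complex.I * ((∑ j, p j * (q j - x j / 2) : ℝ) : ℂ) / ħ := by
      simp only [mul_sub, Finset.sum_sub_distrib]
      push_cast; ring
    rw [e]
    simp only [Matrix.cons_val_zero, Matrix.cons_val_one]
    ring
  have key := ae_eq_zero_of_integral_exp_sum_mul_eq_zero hħ ((hi y₁ r₁).sub (hi y₂ r₂)) fun p => by
    have h0 := h fun a => ![x a.1, p a.1] a.2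
    rw [he, he] at h0
    have h1 := mul_left_cancel₀ (Complex.exp_ne_zero _) h0
    have hI : ∀ y r : ModeSpace ι, Integrable fun q : ι → ℝ =>
        Complex.exp (Complex.I * ((∑ j, p j * q j : ℝ) : ℂ) / ħ) *
          ((starRingEnd ℂ) (y q) * r (q - x)) := by
      intro y r
      have hc : Continuous fun q : ι → ℝ =>
        Complex.exp (Complex.I * ((∑ j, p j * q j : ℝ) : ℂ) / ħ) := by fun_prop
      refine (hi y r).mono (hc.aestronglyMeasurable.mul (hi y r).1) (.of_forall fun q => ?_)
      rw [norm_mul, show Complex.I * ((∑ j, p j * q j : ℝ) : ℂ) / ħ =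
        (((∑ j, p j * q j) / ħ : ℝ) : ℂ) * Complex.I by push_cast; ring,
        Complex.norm_exp_ofReal_mul_I, one_mul]
    simp only [Pi.sub_apply, mul_sub]
    rw [integral_sub (hI y₁ r₁) (hI y₂ r₂), h1, sub_self]
  filter_upwards [key] with q hq
  exact sub_eq_zero.1 hq

/-- By Fubini the pointwise identities for all shifts hold almost everywhere in (x, q), and the
shear (s, t) ↦ (s - t, t) turns them into conj(y₁(s)) r₁(t) = conj(y₂(s)) r₂(t). Integrating against
f(s) conj(g(t)) gives the claim. -/
theorem inner_mul_inner_eq_of_inner_displacement_eq {ħ : ℝ} (hħ : ħ ≠ 0)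
    {y₁ r₁ y₂ r₂ : ModeSpace ι}
    (h : ∀ w, inner ℂ y₁ (displacement ħ w r₁) = inner ℂ y₂ (displacement ħ w r₂))
    (f g : ModeSpace ι) :
    inner ℂ y₁ f * inner ℂ g r₁ = inner ℂ y₂ f * inner ℂ g r₂ := by
  have hm : ∀ u : ModeSpace ι, Measurable u := fun u => (Lp.stronglyMeasurable u).measurable
  have hae : ∀ᵐ z : (ι → ℝ) × (ι → ℝ),
      (starRingEnd ℂ) (y₁ (z.2 + z.1)) * r₁ z.2 = (starRingEnd ℂ) (y₂ (z.2 + z.1)) * r₂ z.2 := by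
    refine (Measure.ae_prod_iff_ae_ae ?_).2 (.of_forall fun x => ?_)
    · have m1 := hm y₁; have m2 := hm y₂; have m3 := hm r₁; have m4 := hm r₂
      refine measurableSet_eq_fun ?_ ?_
      · exact (Complex.continuous_conj.measurable.comp (m1.comp (by fun_prop))).mul
          (m3.comp measurable_snd)
      · exact (Complex.continuous_conj.measurable.comp (m2.comp (by fun_prop))).mul
          (m4.comp measurable_snd)
    · have := (measurePreserving_add_right (volume : Measure (ι → ℝ)) x).quasiMeasurePreserving.ae
        (ae_conj_mul_shift_eq_of_inner_displacement_eq hħ h x)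
      filter_upwards [this] with q hq
      simpa using hq
  have hae' := (measurePreserving_sub_prod (volume : Measure (ι → ℝ))
    (volume : Measure (ι → ℝ))).quasiMeasurePreserving.ae hae
  have hp : ∀ y r : ModeSpace ι, inner ℂ y f * inner ℂ g r =
      ∫ z : (ι → ℝ) × (ι → ℝ), ((starRingEnd ℂ) (y z.1) * r z.2) *
        (f z.1 * (starRingEnd ℂ) (g z.2)) := by
    intro y r
    rw [L2.inner_def, L2.inner_def, ← integral_prod_mul]
    refine integral_congr_ae (.of_forall fun z => ?_)
    simp only [RCLike.inner_apply]
    ring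
  rw [hp, hp]
  refine integral_congr_ae ?_
  filter_upwards [hae'] with z hz
  simp only [add_sub_cancel] at hz
  rw [hz]

/-- Schur's lemma in terms of matrix elements: choosing `g`, `h` with ⟨g, h⟩ ≠ 0 shows that `A` is a
scalar. It follows from the previous identity applied to the pairs (g, A f) and (A* g, f). -/
theorem inner_mul_inner_eq_of_commute_displacement {ħ : ℝ} (hħ : ħ ≠ 0)
    {A : ModeSpace ι →L[ℂ] ModeSpace ι}
    (hA : ∀ w ψ, A (displacement ħ w ψ) = displacement ħ w (A ψ)) (f g h k : ModeSpace ι) :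
    inner ℂ g h * inner ℂ k (A f) = inner ℂ g (A h) * inner ℂ k f := by
  rw [← ContinuousLinearMap.adjoint_inner_left A h g]
  refine inner_mul_inner_eq_of_inner_displacement_eq hħ (fun w => ?_) h k
  rw [← hA, ContinuousLinearMap.adjoint_inner_left]

end Displacement

/-! ### Product vectors -/

section ProductVector

variable {ι κ : Type} [Fintype ι] [Fintype κ]

theorem productVector_ae (φ : ModeSpace ι) (χ : ModeSpace κ) :
    productVector φ χ =ᵐ[volume] fun q : ι ⊕ κ → ℝ =>
      φ (fun i => q (Sum.inl i)) * χ (fun k => q (Sum.inr k)) :=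
  (memLp_productVector φ χ).coeFn_toLp

theorem quasiMeasurePreserving_inl :
    Measure.QuasiMeasurePreserving (fun (q : ι ⊕ κ → ℝ) (i : ι) => q (Sum.inl i)) :=
  Measure.quasiMeasurePreserving_fst.comp (volume_measurePreserving_sumPiEquivProdPi
    (fun _ : ι ⊕ κ => ℝ)).quasiMeasurePreserving

theorem quasiMeasurePreserving_inr :
    Measure.QuasiMeasurePreserving (fun (q : ι ⊕ κ → ℝ) (k : κ) => q (Sum.inr k)) :=
  Measure.quasiMeasurePreserving_snd.comp (volume_measurePreserving_sumPiEquivProdPi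
    (fun _ : ι ⊕ κ => ℝ)).quasiMeasurePreserving

theorem productVector_add_left (φ φ' : ModeSpace ι) (χ : ModeSpace κ) :
    productVector (φ + φ') χ = productVector φ χ + productVector φ' χ := by
  refine Lp.ext ?_
  filter_upwards [productVector_ae (φ + φ') χ, productVector_ae φ χ, productVector_ae φ' χ,
    Lp.coeFn_add (productVector φ χ) (productVector φ' χ),
    quasiMeasurePreserving_inl.ae_eq_comp (Lp.coeFn_add φ φ')] with q h1 h2 h3 h4 h5
  simp only [Function.comp_apply, Pi.add_apply] at h4 h5
  rw [h1, h4, h2, h3, h5, add_mul]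

theorem productVector_add_right (φ : ModeSpace ι) (χ χ' : ModeSpace κ) :
    productVector φ (χ + χ') = productVector φ χ + productVector φ χ' := by
  refine Lp.ext ?_
  filter_upwards [productVector_ae φ (χ + χ'), productVector_ae φ χ, productVector_ae φ χ',
    Lp.coeFn_add (productVector φ χ) (productVector φ χ'),
    quasiMeasurePreserving_inr.ae_eq_comp (Lp.coeFn_add χ χ')] with q h1 h2 h3 h4 h5
  simp only [Function.comp_apply, Pi.add_apply] at h4 h5
  rw [h1, h4, h2, h3, h5, mul_add]

theorem productVector_smul_left (c : ℂ) (φ : ModeSpace ι) (χ : ModeSpace κ) :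
    productVector (c • φ) χ = c • productVector φ χ := by
  refine Lp.ext ?_
  filter_upwards [productVector_ae (c • φ) χ, productVector_ae φ χ,
    Lp.coeFn_smul c (productVector φ χ),
    quasiMeasurePreserving_inl.ae_eq_comp (Lp.coeFn_smul c φ)] with q h1 h2 h4 h5
  simp only [Function.comp_apply, Pi.smul_apply, smul_eq_mul] at h4 h5
  rw [h1, h4, h2, h5, mul_assoc]

theorem productVector_smul_right (c : ℂ) (φ : ModeSpace ι) (χ : ModeSpace κ) :
    productVector φ (c • χ) = c • productVector φ χ := by
  refine Lp.ext ?_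
  filter_upwards [productVector_ae φ (c • χ), productVector_ae φ χ,
    Lp.coeFn_smul c (productVector φ χ),
    quasiMeasurePreserving_inr.ae_eq_comp (Lp.coeFn_smul c χ)] with q h1 h2 h4 h5
  simp only [Function.comp_apply, Pi.smul_apply, smul_eq_mul] at h4 h5
  rw [h1, h4, h2, h5, mul_left_comm]

theorem inner_productVector (φ φ' : ModeSpace ι) (χ χ' : ModeSpace κ) :
    inner ℂ (productVector φ χ) (productVector φ' χ') = inner ℂ φ φ' * inner ℂ χ χ' := by
  rw [L2.inner_def, L2.inner_def, L2.inner_def, ← integral_prod_mul]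
  refine Eq.trans (integral_congr_ae ?_)
    ((volume_measurePreserving_sumPiEquivProdPi (fun _ : ι ⊕ κ => ℝ)).integral_comp
      (MeasurableEquiv.measurableEmbedding _) _)
  filter_upwards [productVector_ae φ χ, productVector_ae φ' χ'] with q h1 h2
  rw [h1, h2]
  simp only [RCLike.inner_apply, map_mul]
  change _ = φ' (fun i => q (Sum.inl i)) * (starRingEnd ℂ) (φ (fun i => q (Sum.inl i))) *
    (χ' (fun k => q (Sum.inr k)) * (starRingEnd ℂ) (χ (fun k => q (Sum.inr k))))
  ring

theorem norm_productVector (φ : ModeSpace ι) (χ : ModeSpace κ) :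
    ‖productVector φ χ‖ = ‖φ‖ * ‖χ‖ := by
  have h := inner_productVector φ φ χ χ
  simp only [inner_self_eq_norm_sq_to_K] at h
  have h' : ‖productVector φ χ‖ ^ 2 = (‖φ‖ * ‖χ‖) ^ 2 := by
    rw [mul_pow]; exact_mod_cast h
  exact (sq_eq_sq₀ (norm_nonneg _) (by positivity)).1 h'

/-- The operator `χ ↦ φ ⊗ χ`. -/
def tensorLeft (κ : Type) [Fintype κ] (φ : ModeSpace ι) :
    ModeSpace κ →L[ℂ] ModeSpace (ι ⊕ κ) :=
  LinearMap.mkContinuous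
    { toFun := fun χ => productVector φ χ
      map_add' := productVector_add_right φ
      map_smul' := fun c χ => productVector_smul_right c φ χ }
    ‖φ‖ fun χ => (norm_productVector φ χ).le

/-- The operator `φ ↦ φ ⊗ χ`. -/
def tensorRight (ι : Type) [Fintype ι] (χ : ModeSpace κ) :
    ModeSpace ι →L[ℂ] ModeSpace (ι ⊕ κ) :=
  LinearMap.mkContinuous
    { toFun := fun φ => productVector φ χ
      map_add' := fun φ φ' => productVector_add_left φ φ' χ
      map_smul' := fun c φ => productVector_smul_left c φ χ }
    ‖χ‖ fun φ => (norm_productVector φ χ).le.trans_eq (mul_comm _ _)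

@[simp]
theorem tensorRight_apply (φ : ModeSpace ι) (χ : ModeSpace κ) :
    tensorRight ι χ φ = productVector φ χ := rfl

/-- The phase-space vector `v ⊕ w`. -/
def joinQuad (v : Quad ι → ℝ) (w : Quad κ → ℝ) : Quad (ι ⊕ κ) → ℝ :=
  fun a => Sum.elim (fun i => v (i, a.2)) (fun k => w (k, a.2)) a.1

theorem displacement_productVector (ħ : ℝ) (v : Quad ι → ℝ) (w : Quad κ → ℝ) (φ : ModeSpace ι)
    (χ : ModeSpace κ) : displacement ħ (joinQuad v w) (productVector φ χ) =
      productVector (displacement ħ v φ) (displacement ħ w χ) := by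
  refine Lp.ext ?_
  filter_upwards [displacement_ae ħ (joinQuad v w) (productVector φ χ),
    (measurePreserving_sub_right (volume : Measure (ι ⊕ κ → ℝ))
      (fun j => joinQuad v w (j, 0))).quasiMeasurePreserving.ae_eq_comp (productVector_ae φ χ),
    productVector_ae (displacement ħ v φ) (displacement ħ w χ),
    quasiMeasurePreserving_inl.ae_eq_comp (displacement_ae ħ v φ),
    quasiMeasurePreserving_inr.ae_eq_comp (displacement_ae ħ w χ)] with q h1 h2 h3 h4 h5
  simp only [Function.comp_apply] at h2 h4 h5
  rw [h1, h2, h3, h4, h5, mul_mul_mul_comm, ← Complex.exp_add]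
  congr 2
  simp only [Fintype.sum_sum_type, joinQuad, Sum.elim_inl, Sum.elim_inr]
  push_cast; ring

variable (ι) in
/-- There is a nowhere vanishing square-integrable function. -/
theorem exists_modeSpace_ae_ne_zero : ∃ g : ModeSpace ι, ∀ᵐ q, g q ≠ 0 := by
  have hc : Continuous fun q : ι → ℝ => ((∏ j, Real.exp (-1 * q j ^ 2) : ℝ) : ℂ) := by fun_prop
  have hg : MemLp (fun q : ι → ℝ => ((∏ j, Real.exp (-1 * q j ^ 2) : ℝ) : ℂ)) 2 volume := by
    rw [memLp_two_iff_integrable_sq_norm hc.aestronglyMeasurable]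
    have := Integrable.fintype_prod (ι := ι) (μ := fun _ => volume)
      (f := fun _ x => Real.exp (-2 * x ^ 2)) fun _ => integrable_exp_neg_mul_sq two_pos
    refine this.congr (.of_forall fun q => ?_)
    simp only
    rw [Complex.norm_real, Real.norm_of_nonneg (by positivity), ← Finset.prod_pow]
    refine Finset.prod_congr rfl fun j _ => ?_
    rw [← Real.exp_nat_mul]; congr 1; push_cast; ring
  refine ⟨hg.toLp _, ?_⟩
  filter_upwards [hg.coeFn_toLp] with q hq
  rw [hq]
  exact_mod_cast (Finset.prod_pos fun j _ => Real.exp_pos _).ne'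

/-- Displacements of a nowhere vanishing product vector are again product vectors, so `y` is
orthogonal to all of them. The Fourier argument at shift zero then makes conj(y) g₁ g₂ vanish almost
everywhere. -/
theorem eq_zero_of_forall_inner_productVector {y : ModeSpace (ι ⊕ κ)}
    (h : ∀ (φ : ModeSpace ι) (χ : ModeSpace κ), inner ℂ y (productVector φ χ) = 0) : y = 0 := by
  obtain ⟨g₁, hg₁⟩ := exists_modeSpace_ae_ne_zero ι
  obtain ⟨g₂, hg₂⟩ := exists_modeSpace_ae_ne_zero κ
  have hi : ∀ w, inner ℂ y (displacement 1 w (productVector g₁ g₂)) =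
      inner ℂ (0 : ModeSpace (ι ⊕ κ)) (displacement 1 w (0 : ModeSpace (ι ⊕ κ))) := by
    intro w
    have : w = joinQuad (fun a => w (Sum.inl a.1, a.2)) (fun a => w (Sum.inr a.1, a.2)) := by
      ext ⟨a | a, b⟩ <;> rfl
    rw [this, displacement_productVector, h, inner_zero_left]
  refine Lp.ext ?_
  filter_upwards [ae_conj_mul_shift_eq_of_inner_displacement_eq one_ne_zero hi 0,
    productVector_ae g₁ g₂, quasiMeasurePreserving_inl.ae hg₁, quasiMeasurePreserving_inr.ae hg₂,
    Lp.coeFn_zero ℂ 2 (volume : Measure (ι ⊕ κ → ℝ))] with q h1 h2 h3 h4 h5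
  rw [sub_zero, h2, h5] at h1
  rw [h5]
  simpa [h3, h4] using h1

end ProductVector

/-! ### Amplification of operators to `ℓ²(L; H)` -/

section Amplification

theorem memℓp_two_iff_summable_sq (L : Type) {E : Type} [NormedAddCommGroup E] {x : L → E} : Memℓp x 2 ↔ Summable fun l => ‖x l‖ ^ 2 := by
  rw [memℓp_gen_iff (by norm_num)]
  norm_num

variable {H : Type} [NormedAddCommGroup H] [InnerProductSpace ℂ H] (L : Type)

/-- The operator `1 ⊗ T` acting coordinatewise on `ℓ²(L; H)`. -/
def amplify (T : H →L[ℂ] H) : lp (fun _ : L => H) 2 →L[ℂ] lp (fun _ : L => H) 2 :=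
  LinearMap.mkContinuous
    { toFun := fun x => ⟨fun l => T (x l), by
        have hx := (memℓp_two_iff_summable_sq L).1 x.2
        refine (memℓp_two_iff_summable_sq L).2
          (Summable.of_nonneg_of_le (fun _ => by positivity) (fun l => ?_)
            (hx.mul_left (‖T‖ ^ 2)))
        rw [← mul_pow]
        exact pow_le_pow_left₀ (norm_nonneg _) (T.le_opNorm _) 2⟩
      map_add' := fun x y => by ext l; exact map_add T _ _
      map_smul' := fun c x => by ext l; exact map_smul T _ _ }
    ‖T‖ fun x => by
      refine lp.norm_le_of_forall_sum_le (by norm_num) (by positivity) fun s => ?_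
      have hx := lp.sum_rpow_le_norm_rpow (p := 2) (by norm_num) x s
      norm_num at hx ⊢
      rw [mul_pow]
      refine le_trans ?_ (mul_le_mul_of_nonneg_left hx (by positivity))
      rw [Finset.mul_sum]
      refine Finset.sum_le_sum fun l _ => ?_
      rw [← mul_pow]
      exact pow_le_pow_left₀ (norm_nonneg _) (T.le_opNorm _) 2

@[simp]
theorem amplify_apply (T : H →L[ℂ] H) (x : lp (fun _ : L => H) 2) (l : L) :
    amplify L T x l = T (x l) := rfl

theorem amplify_single [DecidableEq L] (T : H →L[ℂ] H) (l : L) (x : H) :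
    amplify L T (lp.single 2 l x) = lp.single 2 l (T x) := by
  ext k
  rcases eq_or_ne k l with rfl | h
  · simp
  · simp [lp.single_apply, h]

theorem inner_amplify_left [CompleteSpace H] (T : H →L[ℂ] H) (x y : lp (fun _ : L => H) 2) :
    inner ℂ (amplify L T x) y = inner ℂ x (amplify L (ContinuousLinearMap.adjoint T) y) := by
  rw [lp.inner_eq_tsum, lp.inner_eq_tsum]
  exact tsum_congr fun l => by simp [ContinuousLinearMap.adjoint_inner_right]

variable {L}

theorem summable_inner_of_summable_sq {x y : L → H} (hx : Summable fun l => ‖x l‖ ^ 2)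
    (hy : Summable fun l => ‖y l‖ ^ 2) : Summable fun l => ‖inner ℂ (x l) (y l)‖ := by
  refine Summable.of_nonneg_of_le (fun _ => norm_nonneg _) (fun l => ?_) (hx.add hy)
  refine (norm_inner_le_norm _ _).trans ?_
  nlinarith [sq_nonneg (‖x l‖ - ‖y l‖), sq_nonneg (‖x l‖), sq_nonneg (‖y l‖)]

theorem summable_sq_apply {G : Type} [NormedAddCommGroup G] [InnerProductSpace ℂ G]
    (T : H →L[ℂ] G) {x : L → H} (hx : Summable fun l => ‖x l‖ ^ 2) :
    Summable fun l => ‖T (x l)‖ ^ 2 := by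
  refine Summable.of_nonneg_of_le (fun _ => by positivity) (fun l => ?_) (hx.mul_left (‖T‖ ^ 2))
  rw [← mul_pow]
  exact pow_le_pow_left₀ (norm_nonneg _) (T.le_opNorm _) 2

/-! ### Parseval's identity for square-summable families -/

theorem hasSum_norm_inner_sq {K : Type} (b : HilbertBasis K ℂ H) (x : H) :
    HasSum (fun k => ‖inner ℂ (b k) x‖ ^ 2) (‖x‖ ^ 2) := by
  have h := b.hasSum_inner_mul_inner x x
  rw [inner_self_eq_norm_sq_to_K] at h
  have h2 : (fun k => inner ℂ x (b k) * inner ℂ (b k) x) =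
      fun k => ((‖inner ℂ (b k) x‖ ^ 2 : ℝ) : ℂ) := by
    funext k
    rw [← inner_conj_symm, RCLike.conj_mul]; norm_cast
  rw [h2] at h
  have h3 : HasSum (fun k => ((‖inner ℂ (b k) x‖ ^ 2 : ℝ) : ℂ)) ((‖x‖ ^ 2 : ℝ) : ℂ) := by
    rw [Complex.ofReal_pow]; exact h
  exact Complex.hasSum_ofReal.1 h3

theorem summable_prod_norm_inner_sq {K : Type} (b : HilbertBasis K ℂ H) {x : L → H}
    (hx : Summable fun l => ‖x l‖ ^ 2) :
    Summable fun z : L × K => ‖inner ℂ (b z.2) (x z.1)‖ ^ 2 := by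
  refine (summable_prod_of_nonneg fun _ => by positivity).2
    ⟨fun l => (hasSum_norm_inner_sq b (x l)).summable, ?_⟩
  simp only [(hasSum_norm_inner_sq b _).tsum_eq]
  exact hx

theorem summable_prod_inner_mul_inner {K : Type} (b : HilbertBasis K ℂ H) {x y : L → H}
    (hx : Summable fun l => ‖x l‖ ^ 2) (hy : Summable fun l => ‖y l‖ ^ 2) :
    Summable fun z : L × K => inner ℂ (x z.1) (b z.2) * inner ℂ (b z.2) (y z.1) := by
  refine Summable.of_norm (Summable.of_nonneg_of_le (fun _ => norm_nonneg _) (fun z => ?_)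
    ((summable_prod_norm_inner_sq b hx).add (summable_prod_norm_inner_sq b hy)))
  rw [norm_mul, norm_inner_symm (x z.1)]
  nlinarith [sq_nonneg (‖inner ℂ (b z.2) (x z.1)‖ - ‖inner ℂ (b z.2) (y z.1)‖),
    sq_nonneg ‖inner ℂ (b z.2) (x z.1)‖, sq_nonneg ‖inner ℂ (b z.2) (y z.1)‖]

/-- For square-summable families the trace of `∑ |y_l⟩⟨x_l|` may be computed in any orthonormal
basis. -/
theorem hasSum_tsum_inner_mul_inner {K : Type} (b : HilbertBasis K ℂ H) {x y : L → H}
    (hx : Summable fun l => ‖x l‖ ^ 2) (hy : Summable fun l => ‖y l‖ ^ 2) :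
    HasSum (fun k => ∑' l, inner ℂ (x l) (b k) * inner ℂ (b k) (y l))
      (∑' l, inner ℂ (x l) (y l)) := by
  have hs := summable_prod_inner_mul_inner b hx hy
  have h1 := (hs.hasSum.prod_fiberwise fun l => b.hasSum_inner_mul_inner (x l) (y l)).tsum_eq
  have h2 : HasSum (fun z : K × L => inner ℂ (x z.2) (b z.1) * inner ℂ (b z.1) (y z.2))
      (∑' l, inner ℂ (x l) (y l)) := by
    rw [h1]; exact (Equiv.prodComm K L).hasSum_iff.2 hs.hasSum
  exact h2.prod_fiberwise fun k => (h2.summable.prod_factor k).hasSum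

/-- Tonelli for a nonnegative double series: summing over the basis first or over the family first
gives the same value. This converts a finite trace into square-summability. -/
theorem summable_sq_of_hasSum_tsum_norm_inner_sq {K : Type} (b : HilbertBasis K ℂ H) {x : L → H}
    (hx : ∀ k, Summable fun l => ‖inner ℂ (b k) (x l)‖ ^ 2) {c : ℝ}
    (hc : HasSum (fun k => ∑' l, ‖inner ℂ (b k) (x l)‖ ^ 2) c) :
    HasSum (fun l => ‖x l‖ ^ 2) c := by
  have hs : Summable fun z : K × L => ‖inner ℂ (b z.1) (x z.2)‖ ^ 2 :=
    (summable_prod_of_nonneg fun _ => by positivity).2 ⟨hx, hc.summable⟩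
  have h1 := (hs.hasSum.prod_fiberwise fun k => (hx k).hasSum).unique hc
  have h2 : HasSum (fun z : L × K => ‖inner ℂ (b z.2) (x z.1)‖ ^ 2) c := by
    rw [← h1]; exact (Equiv.prodComm L K).hasSum_iff.2 hs.hasSum
  exact h2.prod_fiberwise fun l => hasSum_norm_inner_sq b (x l)

end Amplification

/-! ### Weyl polynomials applied to a square-summable family -/

section Density

variable {ι κ L : Type} [Fintype ι] [Fintype κ]

theorem eq_zero_of_forall_inner_single_productVector [DecidableEq L]
    {x : lp (fun _ : L => ModeSpace (ι ⊕ κ)) 2}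
    (h : ∀ l (φ : ModeSpace ι) (χ : ModeSpace κ),
      inner ℂ x (lp.single 2 l (productVector φ χ)) = 0) : x = 0 := by
  ext l : 2
  refine eq_zero_of_forall_inner_productVector fun φ χ => ?_
  rw [← lp.inner_single_right l, h]

theorem clm_eq_zero_of_forall_inner_single_productVector [DecidableEq L]
    {D : lp (fun _ : L => ModeSpace (ι ⊕ κ)) 2 →L[ℂ] lp (fun _ : L => ModeSpace (ι ⊕ κ)) 2}
    (h : ∀ l l' (φ φ' : ModeSpace ι) (χ χ' : ModeSpace κ),
      inner ℂ (lp.single 2 l (productVector φ χ)) (D (lp.single 2 l' (productVector φ' χ'))) = 0) :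
    D = 0 := by
  have h1 : ∀ l' (φ' : ModeSpace ι) (χ' : ModeSpace κ),
      D (lp.single 2 l' (productVector φ' χ')) = 0 := by
    intro l' φ' χ'
    refine eq_zero_of_forall_inner_single_productVector fun l φ χ => ?_
    rw [← inner_conj_symm, h, map_zero]
  rw [← ContinuousLinearMap.adjoint.map_eq_zero_iff]
  ext1 z
  refine eq_zero_of_forall_inner_single_productVector fun l φ χ => ?_
  rw [ContinuousLinearMap.adjoint_inner_left, h1, inner_zero_right]

theorem adjoint_tensorRight_productVector (f : ModeSpace κ) (φ : ModeSpace ι) (χ : ModeSpace κ) :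
    ContinuousLinearMap.adjoint (tensorRight ι f) (productVector φ χ) = inner ℂ f χ • φ := by
  refine ext_inner_left ℂ fun y => ?_
  rw [ContinuousLinearMap.adjoint_inner_right, tensorRight_apply, inner_productVector,
    inner_smul_right, mul_comm]

/-- The operator `1 ⊗ |h⟩⟨f|`. -/
def rankOneRight (ι : Type) [Fintype ι] (h f : ModeSpace κ) :
    ModeSpace (ι ⊕ κ) →L[ℂ] ModeSpace (ι ⊕ κ) :=
  tensorRight ι h ∘L ContinuousLinearMap.adjoint (tensorRight ι f)

theorem rankOneRight_productVector (h f : ModeSpace κ) (φ : ModeSpace ι) (χ : ModeSpace κ) :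
    rankOneRight ι h f (productVector φ χ) = inner ℂ f χ • productVector φ h := by
  rw [rankOneRight, ContinuousLinearMap.comp_apply, adjoint_tensorRight_productVector, map_smul,
    tensorRight_apply]

theorem adjoint_rankOneRight (h f : ModeSpace κ) :
    ContinuousLinearMap.adjoint (rankOneRight ι h f) = rankOneRight ι f h := by
  rw [rankOneRight, ContinuousLinearMap.adjoint_comp, ContinuousLinearMap.adjoint_adjoint,
    rankOneRight]

/-- An operator commuting with all displacements of the second system commutes with all operators
`1 ⊗ |h⟩⟨f|`. -/
theorem commute_amplify_rankOneRight {ħ : ℝ} (hħ : ħ ≠ 0)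
    {P : lp (fun _ : L => ModeSpace (ι ⊕ κ)) 2 →L[ℂ] lp (fun _ : L => ModeSpace (ι ⊕ κ)) 2}
    (hP : ∀ (w : Quad κ → ℝ) x, P (amplify L (displacement ħ (joinQuad 0 w)) x) =
      amplify L (displacement ħ (joinQuad 0 w)) (P x)) (h f : ModeSpace κ) :
    P ∘L amplify L (rankOneRight ι h f) = amplify L (rankOneRight ι h f) ∘L P := by
  classical
  rw [← sub_eq_zero]
  refine clm_eq_zero_of_forall_inner_single_productVector fun l l' φ φ' χ χ' => ?_
  -- The embedding χ ↦ e_l ⊗ φ ⊗ χ; it intertwines D_w with the amplified D_{0 ⊕ w}.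
  let J : L → ModeSpace ι → ModeSpace κ →L[ℂ] lp (fun _ : L => ModeSpace (ι ⊕ κ)) 2 :=
    fun l φ => lp.singleContinuousLinearMap ℂ (fun _ : L => ModeSpace (ι ⊕ κ)) 2 l ∘L tensorLeft κ φ
  have hJ : ∀ l φ (χ : ModeSpace κ), J l φ χ = lp.single 2 l (productVector φ χ) :=
    fun _ _ _ => rfl
  have hDJ : ∀ l φ w (χ : ModeSpace κ), amplify L (displacement ħ (joinQuad 0 w)) (J l φ χ) =
      J l φ (displacement ħ w χ) := by
    intro l φ w χ
    rw [hJ, hJ, amplify_single, displacement_productVector, displacement_zero]; rfl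
  have hneg : ∀ w : Quad κ → ℝ, -(joinQuad (0 : Quad ι → ℝ) w) = joinQuad 0 (-w) := by
    intro w; ext ⟨a | a, b⟩ <;> simp [joinQuad]
  -- This block of `P` acts on the second system alone and commutes with every displacement, so
  -- Schur's lemma makes it a scalar; scalars commute with |h⟩⟨f|.
  let A := ContinuousLinearMap.adjoint (J l φ) ∘L P ∘L J l' φ'
  have hAi : ∀ a b, inner ℂ a (A b) = inner ℂ (J l φ a) (P (J l' φ' b)) := fun a b => by
    simp only [A, ContinuousLinearMap.comp_apply, ContinuousLinearMap.adjoint_inner_right]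
  have hA : ∀ w ψ, A (displacement ħ w ψ) = displacement ħ w (A ψ) := by
    intro w ψ
    refine ext_inner_left ℂ fun y => ?_
    rw [hAi, ← hDJ, hP, ← neg_neg w, ← inner_displacement_left, hAi, ← hDJ, inner_amplify_left,
      adjoint_displacement, hneg]
  have key := inner_mul_inner_eq_of_commute_displacement hħ hA χ' χ h f
  rw [hAi, hAi] at key
  rw [_root_.sub_apply, inner_sub_right, ContinuousLinearMap.comp_apply,
    ContinuousLinearMap.comp_apply, amplify_single, rankOneRight_productVector, lp.single_smul,
    map_smul, inner_smul_right, sub_eq_zero]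
  have ha : ContinuousLinearMap.adjoint (amplify L (rankOneRight ι h f)) =
      amplify L (rankOneRight ι f h) := by
    refine ((ContinuousLinearMap.eq_adjoint_iff _ _).2 fun x y => ?_).symm
    rw [inner_amplify_left, adjoint_rankOneRight]
  rw [← ContinuousLinearMap.adjoint_inner_left (amplify L (rankOneRight ι h f)), ha,
    amplify_single, rankOneRight_productVector, lp.single_smul, inner_smul_left,
    inner_conj_symm, ← hJ, ← hJ, ← hJ, ← hJ, key, mul_comm]

/-- The density half of the bicommutant theorem. The closed cyclic subspace `M` of `R` is stable
under the displacements and their adjoints, so its projection P commutes with them and hence with T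
= 1 ⊗ |h⟩⟨f|. Then T R = T P R = P T R lies in `M`. -/
theorem amplify_rankOneRight_mem_closure {ħ : ℝ} (hħ : ħ ≠ 0)
    (R : lp (fun _ : L => ModeSpace (ι ⊕ κ)) 2) (h f : ModeSpace κ) :
    amplify L (rankOneRight ι h f) R ∈ (Submodule.span ℂ (Set.range fun w : Quad κ → ℝ =>
      amplify L (displacement ħ (joinQuad (0 : Quad ι → ℝ) w)) R)).topologicalClosure := by
  set M := (Submodule.span ℂ (Set.range fun w : Quad κ → ℝ =>
      amplify L (displacement ħ (joinQuad (0 : Quad ι → ℝ) w)) R)).topologicalClosure with hM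
  have : CompleteSpace M := (Submodule.isClosed_topologicalClosure _).completeSpace_coe
  have hgen : ∀ w : Quad κ → ℝ,
      amplify L (displacement ħ (joinQuad (0 : Quad ι → ℝ) w)) R ∈ M := fun w =>
    Submodule.le_topologicalClosure _ (Submodule.subset_span ⟨w, rfl⟩)
  have hR : R ∈ M := by
    have h0 := hgen 0
    have e : joinQuad (0 : Quad ι → ℝ) (0 : Quad κ → ℝ) = 0 := by
      ext ⟨a | a, b⟩ <;> simp [joinQuad]
    rw [e, displacement_zero] at h0
    exact h0
  -- By the Weyl relation a product of two displacements is a displacement up to a phase, so the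
  -- linear span is already stable under the whole group.
  have hadd : ∀ w w' : Quad κ → ℝ,
      joinQuad (0 : Quad ι → ℝ) w + joinQuad 0 w' = joinQuad 0 (w + w') := by
    intro w w'; ext ⟨a | a, b⟩ <;> simp [joinQuad]
  have hinv : ∀ (w : Quad κ → ℝ), ∀ m ∈ M,
      amplify L (displacement ħ (joinQuad (0 : Quad ι → ℝ) w)) m ∈ M := by
    intro w
    have hle : M ≤ M.comap
        (amplify L (displacement ħ (joinQuad (0 : Quad ι → ℝ) w))).toLinearMap := by
      refine Submodule.topologicalClosure_minimal _ (Submodule.span_le.2 ?_) ?_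
      · rintro _ ⟨w', rfl⟩
        have e : amplify L (displacement ħ (joinQuad (0 : Quad ι → ℝ) w))
            (amplify L (displacement ħ (joinQuad (0 : Quad ι → ℝ) w')) R) =
            Complex.exp (Complex.I * (weylPhase ħ (joinQuad (0 : Quad ι → ℝ) w)
              (joinQuad (0 : Quad ι → ℝ) w') : ℂ)) •
            amplify L (displacement ħ (joinQuad (0 : Quad ι → ℝ) (w + w'))) R := by
          ext l : 2
          simp only [amplify_apply, lp.coeFn_smul, Pi.smul_apply]
          rw [displacement_displacement, hadd]
        change amplify L (displacement ħ (joinQuad (0 : Quad ι → ℝ) w))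
            (amplify L (displacement ħ (joinQuad (0 : Quad ι → ℝ) w')) R) ∈ M
        rw [e]
        exact M.smul_mem _ (hgen _)
      · exact (Submodule.isClosed_topologicalClosure _).preimage
          (amplify L (displacement ħ (joinQuad (0 : Quad ι → ℝ) w))).continuous
    exact fun m hm => hle hm
  have hneg : ∀ w : Quad κ → ℝ, -(joinQuad (0 : Quad ι → ℝ) w) = joinQuad 0 (-w) := by
    intro w; ext ⟨a | a, b⟩ <;> simp [joinQuad]
  have hcomm : ∀ (w : Quad κ → ℝ) x,
      M.starProjection (amplify L (displacement ħ (joinQuad 0 w)) x) =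
      amplify L (displacement ħ (joinQuad 0 w)) (M.starProjection x) := by
    intro w x
    refine Submodule.eq_starProjection_of_mem_of_inner_eq_zero
      (hinv w _ (Submodule.starProjection_apply_mem _ _)) fun m hm => ?_
    rw [← map_sub, inner_amplify_left, adjoint_displacement, hneg]
    exact Submodule.starProjection_inner_eq_zero _ _ (hinv _ _ hm)
  have key := DFunLike.congr_fun (commute_amplify_rankOneRight hħ hcomm h f) R
  rw [ContinuousLinearMap.comp_apply, ContinuousLinearMap.comp_apply,
    Submodule.starProjection_eq_self_iff.2 hR] at key
  rw [← key]
  exact Submodule.starProjection_apply_mem _ _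

end Density

/-! ### Positive definite kernels -/

theorem posSemidef_pow_entries {I : Type} [Fintype I] {G : Matrix I I ℂ} (hG : G.PosSemidef)
    (k : ℕ) : (Matrix.of fun i j => G i j ^ k).PosSemidef := by
  induction k with
  | zero =>
    have h := posSemidef_vecMulVec_self_star (fun _ : I => (1 : ℂ))
    convert h using 1
    ext i j; simp [vecMulVec_apply]
  | succ k ih =>
    have e : (Matrix.of fun i j => G i j ^ (k + 1)) = (Matrix.of fun i j => G i j ^ k) ⊙ G := by
      ext i j; simp [pow_succ]
    rw [e]
    exact ih.hadamard hG

/-- The entrywise exponential is a convergent series of Hadamard powers with nonnegative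
coefficients, each positive semidefinite by Schur's product theorem. -/
theorem posSemidef_exp_entries {I : Type} [Fintype I] {G : Matrix I I ℂ} (hG : G.PosSemidef) :
    (Matrix.of fun i j => Complex.exp (G i j)).PosSemidef := by
  refine .of_dotProduct_mulVec_nonneg ?_ fun x => ?_
  · ext i j
    simp only [conjTranspose_apply, of_apply, Complex.star_def, ← Complex.exp_conj]
    rw [← hG.1.apply i j]; rfl
  · have hs : HasSum (fun k : ℕ => ((k.factorial : ℂ))⁻¹ *
        (star x ⬝ᵥ ((Matrix.of fun i j => G i j ^ k) *ᵥ x)))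
        (star x ⬝ᵥ ((Matrix.of fun i j => Complex.exp (G i j)) *ᵥ x)) := by
      simp only [dotProduct, mulVec, of_apply, Finset.mul_sum]
      refine hasSum_sum fun i _ => hasSum_sum fun j _ => ?_
      have h := (NormedSpace.expSeries_div_hasSum_exp (G i j)).mul_left (star x i)
      rw [← Complex.exp_eq_exp_ℂ] at h
      rw [← mul_assoc]
      refine (h.mul_right (x j)).congr_fun fun k => ?_
      ring
    refine hs.nonneg fun k => mul_nonneg ?_ ?_
    · simp
    · exact (posSemidef_pow_entries hG k).dotProduct_mulVec_nonneg x

/-- For a positive semidefinite `G` the normalised kernel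
`exp(G(x, y) - G(x, x)/2 - G(y, y)/2)` is positive semidefinite. -/
theorem posSemidef_exp_normalized {I : Type} [Fintype I] {G : Matrix I I ℂ} (hG : G.PosSemidef) :
    (Matrix.of fun i j => Complex.exp (G i j - G i i / 2 - G j j / 2)).PosSemidef := by
  classical
  have h := (posSemidef_exp_entries hG).conjTranspose_mul_mul_same
    (Matrix.diagonal fun i => Complex.exp (-(G i i / 2)))
  convert h using 1
  ext i j
  have hi : (starRingEnd ℂ) (G i i) = G i i := hG.1.apply i i
  rw [diagonal_conjTranspose, mul_diagonal, diagonal_mul]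
  simp only [of_apply, Pi.star_apply, Complex.star_def, ← Complex.exp_conj, ← Complex.exp_add]
  simp only [map_neg, map_div₀, hi, map_ofNat]
  congr 1; ring

/-- Testing `K` on (x, -u x), where the phase u makes u t = |t| for the off-diagonal value t, yields
2c - 2|t| ≥ 0. -/
theorem norm_offDiagonal_le_of_posSemidef {I : Type} [Fintype I] {K : Matrix (I ⊕ I) (I ⊕ I) ℂ}
    (hK : K.PosSemidef) (x : I → ℂ) {c : ℝ}
    (h₁ : ∑ i, ∑ j, star (x i) * x j * K (Sum.inl i) (Sum.inl j) = c)
    (h₂ : ∑ i, ∑ j, star (x i) * x j * K (Sum.inr i) (Sum.inr j) = c) :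
    ‖∑ i, ∑ j, star (x i) * x j * K (Sum.inl i) (Sum.inr j)‖ ≤ c := by
  set t := ∑ i, ∑ j, star (x i) * x j * K (Sum.inl i) (Sum.inr j) with ht
  obtain ⟨u, hu, hut⟩ : ∃ u : ℂ, ‖u‖ = 1 ∧ u * t = ‖t‖ := by
    rcases eq_or_ne t 0 with h0 | h0
    · exact ⟨1, by simp, by simp [h0]⟩
    · refine ⟨(starRingEnd ℂ) t / ‖t‖, ?_, ?_⟩
      · rw [norm_div, RCLike.norm_conj, Complex.norm_real, norm_norm, div_self (norm_ne_zero_iff.2 h0)]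
      · rw [div_mul_eq_mul_div, RCLike.conj_mul, sq, mul_div_assoc]
        have : (‖t‖ : ℂ) ≠ 0 := by exact_mod_cast norm_ne_zero_iff.2 h0
        simp [this]
  have hpos := hK.dotProduct_mulVec_nonneg (Sum.elim x fun i => -u * x i)
  have huu : star u * u = 1 := by
    have := RCLike.conj_mul u
    rw [hu] at this; simpa using this
  have ht' : ∑ i, ∑ j, star (x i) * x j * K (Sum.inr i) (Sum.inl j) = star t := by
    rw [ht, star_sum, Finset.sum_comm]
    refine Finset.sum_congr rfl fun i _ => ?_
    rw [star_sum]
    refine Finset.sum_congr rfl fun j _ => ?_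
    rw [star_mul', star_mul', star_star, hK.1.apply]
    ring
  have e : star (Sum.elim x fun i => -u * x i) ⬝ᵥ (K *ᵥ Sum.elim x fun i => -u * x i) =
      c + star u * u * c - u * t - star (u * t) := by
    rw [star_mul', ← ht', ← h₁]
    nth_rw 2 [h₁]; rw [← h₂, ht]
    simp only [dotProduct, mulVec, Fintype.sum_sum_type, Finset.mul_sum, Finset.sum_add_distrib,
      mul_add, Pi.star_apply, Sum.elim_inl, Sum.elim_inr]
    have h3 : ∀ (A : Matrix I I ℂ) (a b : ℂ), ∑ i, ∑ j, star (a * x i) * (A i j * (b * x j)) =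
        star a * b * ∑ i, ∑ j, star (x i) * x j * A i j := by
      intro A a b
      rw [Finset.mul_sum]
      refine Finset.sum_congr rfl fun i _ => ?_
      rw [Finset.mul_sum]
      refine Finset.sum_congr rfl fun j _ => ?_
      rw [star_mul']; ring
    have a1 := h3 (Matrix.of fun i j => K (Sum.inl i) (Sum.inl j)) 1 1
    have a2 := h3 (Matrix.of fun i j => K (Sum.inl i) (Sum.inr j)) 1 (-u)
    have a3 := h3 (Matrix.of fun i j => K (Sum.inr i) (Sum.inl j)) (-u) 1
    have a4 := h3 (Matrix.of fun i j => K (Sum.inr i) (Sum.inr j)) (-u) (-u)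
    simp only [one_mul, of_apply, star_one, mul_one] at a1 a2 a3 a4
    simp only [← Finset.mul_sum] at a1 a2 a3 a4 ⊢
    rw [a1, a2, a3, a4, star_neg]
    ring
  rw [e, huu, hut] at hpos
  have h4 : (0 : ℂ) ≤ ((2 * c - 2 * ‖t‖ : ℝ) : ℂ) := by
    refine hpos.trans_eq ?_
    rw [Complex.star_def, Complex.conj_ofReal]
    push_cast; ring
  have h5 : (0 : ℝ) ≤ 2 * c - 2 * ‖t‖ := by exact_mod_cast h4
  linarith

/-- A Hermitian matrix `G` is positive semidefinite if the kernels `exp(t G)`, extended by a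
point at the origin, are positive semidefinite for small `t > 0`. -/
theorem posSemidef_of_exp_entries {I : Type} [Fintype I] {G : Matrix I I ℂ} (hG : G.IsHermitian)
    (h : ∀ t : ℝ, 0 < t → (Matrix.of fun i j : Option I => Complex.exp
      (t * i.elim 0 fun a => j.elim 0 fun b => G a b)).PosSemidef) : G.PosSemidef := by
  refine .of_dotProduct_mulVec_nonneg hG fun x => ?_
  have hlim : Filter.Tendsto (fun t : ℝ => ∑ i, ∑ j, star (x i) * x j *
      ((t⁻¹ : ℝ) • (Complex.exp (((0 + t : ℝ) : ℂ) * G i j) -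
        Complex.exp (((0 : ℝ) : ℂ) * G i j))))
      (nhdsWithin 0 (Set.Ioi 0)) (nhds (star x ⬝ᵥ (G *ᵥ x))) := by
    have e : star x ⬝ᵥ (G *ᵥ x) = ∑ i, ∑ j, star (x i) * x j * G i j := by
      simp only [dotProduct, mulVec, Finset.mul_sum, Pi.star_apply]
      exact Finset.sum_congr rfl fun i _ => Finset.sum_congr rfl fun j _ => by ring
    rw [e]
    refine tendsto_finsetSum _ fun i _ => tendsto_finsetSum _ fun j _ =>
      Filter.Tendsto.const_mul _ ?_
    have hd : HasDerivAt (fun t : ℝ => Complex.exp ((t : ℂ) * G i j)) (G i j) 0 := by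
      have h1 : HasDerivAt (fun t : ℝ => (t : ℂ) * G i j) (1 * G i j) 0 :=
        (HasDerivAt.ofReal_comp (hasDerivAt_id (0 : ℝ))).mul_const _
      have h2 := h1.cexp
      simpa using h2
    exact hd.tendsto_slope_zero_right
  refine ge_of_tendsto hlim ?_
  filter_upwards [self_mem_nhdsWithin] with t ht
  have ht' : (0 : ℝ) < t := ht
  -- Weighting the extra point by -∑ x_i makes the total weight zero. The extra row and column then
  -- turn each exp(t G_ij) into exp(t G_ij) - 1, whose quotient by t tends to G_ij.
  have hp := (h t ht').dotProduct_mulVec_nonneg fun i => i.elim (-∑ i, x i) x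
  have hti : (0 : ℂ) ≤ ((t⁻¹ : ℝ) : ℂ) := by
    exact_mod_cast (inv_pos.2 ht').le
  refine (mul_nonneg hti hp).trans_eq ?_
  have e1 : ∑ i, ∑ j, star (x i) * x j * ((t⁻¹ : ℝ) • (Complex.exp (((0 + t : ℝ) : ℂ) * G i j) -
      Complex.exp (((0 : ℝ) : ℂ) * G i j))) = ((t⁻¹ : ℝ) : ℂ) *
      ((∑ i, ∑ j, star (x i) * (Complex.exp (t * G i j) * x j)) -
        (∑ i, star (x i)) * ∑ j, x j) := by
    rw [Finset.sum_mul_sum, ← Finset.sum_sub_distrib, Finset.mul_sum]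
    refine Finset.sum_congr rfl fun i _ => ?_
    rw [← Finset.sum_sub_distrib, Finset.mul_sum]
    refine Finset.sum_congr rfl fun j _ => ?_
    rw [zero_add, Complex.ofReal_zero, zero_mul, Complex.exp_zero, Complex.real_smul]
    ring
  rw [e1]
  congr 1
  simp only [dotProduct, mulVec, Fintype.sum_option, of_apply, Option.elim, Pi.star_apply,
    mul_zero, Complex.exp_zero, one_mul, mul_add, Finset.sum_add_distrib, star_neg, star_sum]
  simp only [Finset.mul_sum, ← Finset.sum_mul]
  ring_nf
  rw [Finset.sum_neg_distrib]
  ring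

/-! ### Gram matrix of the displaced Gaussian family -/

section GaussianGram

variable {ι κ : Type} [Fintype ι] [DecidableEq ι] [Fintype κ] [DecidableEq κ]

theorem symplecticForm_mulVec_zero (v : Quad ι → ℝ) (j : ι) :
    (symplecticForm ι *ᵥ v) (j, 0) = v (j, 1) := by
  simp [symplecticForm, mulVec, dotProduct, Fintype.sum_prod_type, Matrix.one_apply]

theorem symplecticForm_mulVec_one (v : Quad ι → ℝ) (j : ι) :
    (symplecticForm ι *ᵥ v) (j, 1) = -v (j, 0) := by
  simp [symplecticForm, mulVec, dotProduct, Fintype.sum_prod_type, Matrix.one_apply]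

/-- The symplectic form `aᵀ Ω b`. -/
def omegaForm (a b : Quad ι → ℝ) : ℝ := a ⬝ᵥ (symplecticForm ι *ᵥ b)

theorem omegaForm_eq (a b : Quad ι → ℝ) :
    omegaForm a b = ∑ j, (a (j, 0) * b (j, 1) - a (j, 1) * b (j, 0)) := by
  simp only [omegaForm, dotProduct, Fintype.sum_prod_type, Fin.sum_univ_two,
    symplecticForm_mulVec_zero, symplecticForm_mulVec_one]
  exact Finset.sum_congr rfl fun j _ => by ring

theorem weylPhase_neg_left (ħ : ℝ) (z w : Quad ι → ℝ) : weylPhase ħ (-z) w =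
    omegaForm (symplecticForm ι *ᵥ z) (symplecticForm ι *ᵥ w) / (2 * ħ) := by
  rw [omegaForm_eq, weylPhase]
  congr 1
  refine Finset.sum_congr rfl fun j _ => ?_
  simp only [symplecticForm_mulVec_zero, symplecticForm_mulVec_one, Pi.neg_apply]
  ring

theorem symplecticForm_mulVec_joinQuad (v : Quad ι → ℝ) (w : Quad κ → ℝ) :
    symplecticForm (ι ⊕ κ) *ᵥ joinQuad v w =
      joinQuad (symplecticForm ι *ᵥ v) (symplecticForm κ *ᵥ w) := by
  ext ⟨a | a, b⟩ <;> fin_cases b <;>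
    simp [symplecticForm_mulVec_zero, symplecticForm_mulVec_one, joinQuad]

theorem omegaForm_joinQuad (a a' : Quad ι → ℝ) (b b' : Quad κ → ℝ) :
    omegaForm (joinQuad a b) (joinQuad a' b') = omegaForm a a' + omegaForm b b' := by
  simp only [omegaForm_eq, Fintype.sum_sum_type]
  rfl

@[simp]
theorem omegaForm_self (a : Quad ι → ℝ) : omegaForm a a = 0 := by
  rw [omegaForm_eq]
  exact Finset.sum_eq_zero fun j _ => by ring

/-- The logarithm of the Gram kernel `⟨D_z R, D_{z'} R⟩`, up to the contribution of the mean,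
as a function of `a = Ωz`, `b = Ωz'`. -/
def gramExponent (ħ : ℝ) (cov : Matrix (Quad ι) (Quad ι) ℝ) (a b : Quad ι → ℝ) : ℂ :=
  ((-((b - a) ⬝ᵥ (cov *ᵥ (b - a)) / (2 * ħ ^ 2)) : ℝ) : ℂ) +
    Complex.I * ((omegaForm a b / (2 * ħ) : ℝ) : ℂ)

/-- Moving D_z to the other side gives D_{-z} D_w, a Weyl phase times D_{w-z}. The mean enters only
through a factor conj(m(z)) m(w), which does not affect positivity. -/
theorem inner_amplify_displacement {L : Type} {ħ : ℝ} {μ : Quad ι → ℝ}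
    {cov : Matrix (Quad ι) (Quad ι) ℝ} {R : lp (fun _ : L => ModeSpace ι) 2}
    (hR : ∀ v : Quad ι → ℝ, inner ℂ R (amplify L (displacement ħ v) R) = Complex.exp
        (-(((symplecticForm ι *ᵥ v) ⬝ᵥ (cov *ᵥ (symplecticForm ι *ᵥ v)) / (2 * ħ ^ 2) : ℝ) : ℂ)
          + Complex.I * ((symplecticForm ι *ᵥ v ⬝ᵥ μ / ħ : ℝ) : ℂ))) (z w : Quad ι → ℝ) :
    inner ℂ (amplify L (displacement ħ z) R) (amplify L (displacement ħ w) R) =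
      (starRingEnd ℂ) (Complex.exp (Complex.I * ((symplecticForm ι *ᵥ z ⬝ᵥ μ / ħ : ℝ) : ℂ))) *
      Complex.exp (Complex.I * ((symplecticForm ι *ᵥ w ⬝ᵥ μ / ħ : ℝ) : ℂ)) *
      Complex.exp (gramExponent ħ cov (symplecticForm ι *ᵥ z) (symplecticForm ι *ᵥ w)) := by
  have e : amplify L (displacement ħ (-z)) (amplify L (displacement ħ w) R) =
      Complex.exp (Complex.I * (weylPhase ħ (-z) w : ℂ)) •
        amplify L (displacement ħ (-z + w)) R := by
    ext l : 2
    simp only [amplify_apply, lp.coeFn_smul, Pi.smul_apply]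
    rw [displacement_displacement]
  have hs : symplecticForm ι *ᵥ (-z + w) = symplecticForm ι *ᵥ w - symplecticForm ι *ᵥ z := by
    rw [neg_add_eq_sub, mulVec_sub]
  rw [inner_amplify_left, adjoint_displacement, e, inner_smul_right, hR, ← Complex.exp_conj,
    ← Complex.exp_add, ← Complex.exp_add, ← Complex.exp_add, weylPhase_neg_left, hs]
  congr 1
  rw [gramExponent, sub_dotProduct (symplecticForm ι *ᵥ w) _ μ, map_mul, Complex.conj_I,
    Complex.conj_ofReal]
  push_cast
  ring

end GaussianGram

/-! ### The uncertainty relation -/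

section Uncertainty

/-- The sesquilinear form of a complex matrix, on real vectors. -/
def realForm {Q : Type} [Fintype Q] (G : Matrix Q Q ℂ) (a b : Q → ℝ) : ℂ :=
  (fun x => (a x : ℂ)) ⬝ᵥ (G *ᵥ fun x => (b x : ℂ))

theorem realForm_directSum {ι κ : Type} [Fintype ι] [Fintype κ]
    (A : Matrix (Quad ι) (Quad ι) ℂ)
    (B : Matrix (Quad κ) (Quad κ) ℂ)
    (a a' : Quad ι → ℝ) (b b' : Quad κ → ℝ) :
    realForm (directSum A B) (joinQuad a b) (joinQuad a' b') =
      realForm A a a' + realForm B b b' := by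
  simp [realForm, directSum, dotProduct, mulVec, Fintype.sum_prod_type, Fintype.sum_sum_type,
    joinQuad, Equiv.sumProdDistrib]

variable {ι κ : Type} [Fintype ι] [DecidableEq ι] [Fintype κ] [DecidableEq κ]

theorem posSemidef_realForm {Q I : Type} [Fintype Q] [Fintype I] {G : Matrix Q Q ℂ}
    (hG : G.PosSemidef) (p : I → Q → ℝ) :
    (Matrix.of fun i j => realForm G (p i) (p j)).PosSemidef := by
  have h := hG.conjTranspose_mul_mul_same (Matrix.of fun (x : Q) (i : I) => (p i x : ℂ))
  convert h using 1
  ext i j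
  simp only [realForm, dotProduct, mulVec, mul_apply, of_apply, conjTranspose_apply,
    Finset.mul_sum, Finset.sum_mul, Complex.star_def, Complex.conj_ofReal]
  rw [Finset.sum_comm]
  exact Finset.sum_congr rfl fun i _ => Finset.sum_congr rfl fun j _ => by ring

theorem realForm_add {Q : Type} [Fintype Q] (G G' : Matrix Q Q ℂ) (a b : Q → ℝ) :
    realForm (G + G') a b = realForm G a b + realForm G' a b := by
  simp [realForm, add_mulVec, dotProduct_add]

theorem realForm_sub {Q : Type} [Fintype Q] (G G' : Matrix Q Q ℂ) (a b : Q → ℝ) :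
    realForm (G - G') a b = realForm G a b - realForm G' a b := by
  simp [realForm, sub_mulVec, dotProduct_sub]

theorem realForm_smul {Q : Type} [Fintype Q] (c : ℂ) (G : Matrix Q Q ℂ) (a b : Q → ℝ) :
    realForm (c • G) a b = c * realForm G a b := by
  simp [realForm, smul_mulVec, dotProduct_smul]

theorem realForm_map_ofReal {Q : Type} [Fintype Q] (G : Matrix Q Q ℝ) (a b : Q → ℝ) :
    realForm (G.map Complex.ofReal) a b = ((a ⬝ᵥ (G *ᵥ b) : ℝ) : ℂ) := by
  simp [realForm, dotProduct, mulVec]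

theorem realForm_halfOmega (ħ : ℝ) (a b : Quad ι → ℝ) :
    realForm (halfOmega ħ ι) a b = Complex.I * ((ħ / 2 * omegaForm a b : ℝ) : ℂ) := by
  rw [halfOmega, realForm_smul, realForm_map_ofReal, omegaForm]
  push_cast; ring

theorem realForm_single {Q : Type} [Fintype Q] [DecidableEq Q] (G : Matrix Q Q ℂ) (i j : Q) :
    realForm G (Pi.single i 1) (Pi.single j 1) = G i j := by
  have h : ∀ i : Q, (fun x => ((Pi.single i 1 : Q → ℝ) x : ℂ)) = Pi.single i 1 := by
    intro i; ext x; simp [Pi.single_apply, apply_ite]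
  simp [realForm, h]

theorem sub_dotProduct_mulVec_sub {Q : Type} [Fintype Q] {S : Matrix Q Q ℝ} (hS : S.IsSymm)
    (a b : Q → ℝ) : (b - a) ⬝ᵥ (S *ᵥ (b - a)) =
      a ⬝ᵥ (S *ᵥ a) + b ⬝ᵥ (S *ᵥ b) - 2 * (a ⬝ᵥ (S *ᵥ b)) := by
  have h : b ⬝ᵥ (S *ᵥ a) = a ⬝ᵥ (S *ᵥ b) := by
    rw [dotProduct_comm, ← vecMul_transpose, hS.eq, ← dotProduct_mulVec]
  rw [mulVec_sub, sub_dotProduct, dotProduct_sub, dotProduct_sub, h]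
  ring

end Uncertainty

/-! ### Gaussian kernels, the uncertainty relation, and the bound for finite sums of displaced
copies -/

section GaussianBound

theorem posSemidef_of_eq_star_mul_mul {I : Type} [Fintype I] {K K' : Matrix I I ℂ}
    (hK : K.PosSemidef) (n : I → ℂ) (h : ∀ i j, K' i j = star (n i) * n j * K i j) :
    K'.PosSemidef := by
  classical
  convert hK.conjTranspose_mul_mul_same (Matrix.diagonal n) using 1
  ext i j
  rw [diagonal_conjTranspose, mul_diagonal, diagonal_mul, h, Pi.star_apply]
  ring

theorem isHermitian_halfOmega {ι : Type} [DecidableEq ι] (ħ : ℝ) : (halfOmega ħ ι).IsHermitian := by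
  ext ⟨i, a⟩ ⟨j, b⟩
  simp only [halfOmega, conjTranspose_apply, Matrix.smul_apply, map_apply, symplecticForm,
    kroneckerMap_apply, smul_eq_mul, Matrix.one_apply, eq_comm (a := i)]
  fin_cases a <;> fin_cases b <;> split_ifs <;> simp

theorem isHermitian_map_ofReal {Q : Type} {S : Matrix Q Q ℝ} (hS : S.IsSymm) :
    (S.map Complex.ofReal).IsHermitian := by
  ext i j
  simp [conjTranspose_apply, hS.apply]

theorem transpose_halfOmega {ι : Type} [DecidableEq ι] (ħ : ℝ) : (halfOmega ħ ι)ᵀ = -halfOmega ħ ι := by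
  ext ⟨i, a⟩ ⟨j, b⟩
  simp only [halfOmega, transpose_apply, Matrix.neg_apply, Matrix.smul_apply, map_apply,
    symplecticForm, kroneckerMap_apply, smul_eq_mul, Matrix.one_apply, eq_comm (a := i)]
  fin_cases a <;> fin_cases b <;> split_ifs <;> simp

variable {ι κ : Type} [Fintype ι] [DecidableEq ι] [Fintype κ] [DecidableEq κ]

/-- The covariance part is a squared distance, hence polarises, and the symplectic form vanishes on
the diagonal; so the exponent is the normalised form of Σ + i(ħ/2)Ω. -/
theorem gramExponent_eq_realForm {ħ : ℝ} (hħ : ħ ≠ 0) {cov : Matrix (Quad ι) (Quad ι) ℝ}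
    (hS : cov.IsSymm) (a b : Quad ι → ℝ) :
    gramExponent ħ cov a b = ((1 / ħ ^ 2 : ℝ) : ℂ) *
      (realForm (cov.map Complex.ofReal + halfOmega ħ ι) a b -
        realForm (cov.map Complex.ofReal + halfOmega ħ ι) a a / 2 -
        realForm (cov.map Complex.ofReal + halfOmega ħ ι) b b / 2) := by
  have h : (ħ : ℂ) ≠ 0 := by exact_mod_cast hħ
  simp only [realForm_add, realForm_map_ofReal, realForm_halfOmega, omegaForm_self, gramExponent,
    sub_dotProduct_mulVec_sub hS]
  push_cast
  field_simp
  ring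

/-- Here the symplectic form of the first system is missing and -Z stands in its place. The
covariance part depends only on differences, so the shift of the first system can be collected in
one argument as a' - a, and Z contributes a separate factor free of b and b'. -/
theorem gramExponent_joinQuad {ħ : ℝ} (hħ : ħ ≠ 0)
    {cov : Matrix (Quad (ι ⊕ κ)) (Quad (ι ⊕ κ)) ℝ} (hS : cov.IsSymm)
    (Z : Matrix (Quad ι) (Quad ι) ℂ) {G : Matrix (Quad (ι ⊕ κ)) (Quad (ι ⊕ κ)) ℂ}
    (hG : G = cov.map Complex.ofReal + directSum 0 (halfOmega ħ κ) - directSum Z 0)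
    (a a' : Quad ι → ℝ) (b b' : Quad κ → ℝ) :
    ((1 / ħ ^ 2 : ℝ) : ℂ) *
      (realForm G (joinQuad a b) (joinQuad a' b') - realForm G (joinQuad a b) (joinQuad a b) / 2 -
        realForm G (joinQuad a' b') (joinQuad a' b') / 2) =
    gramExponent ħ cov (joinQuad 0 b) (joinQuad (a' - a) b') -
      ((1 / ħ ^ 2 : ℝ) : ℂ) *
        (realForm Z a a' - realForm Z a a / 2 - realForm Z a' a' / 2) := by
  have h : (ħ : ℂ) ≠ 0 := by exact_mod_cast hħ
  have e : joinQuad (a' - a) b' - joinQuad 0 b = joinQuad a' b' - joinQuad a b := by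
    ext ⟨x | x, y⟩ <;> simp [joinQuad]
  have e0 : ∀ x y : Quad ι → ℝ, realForm (0 : Matrix (Quad ι) (Quad ι) ℂ) x y = 0 := by
    intro x y; simp [realForm]
  have e0' : ∀ x y : Quad κ → ℝ, realForm (0 : Matrix (Quad κ) (Quad κ) ℂ) x y = 0 := by
    intro x y; simp [realForm]
  have e1 : omegaForm (0 : Quad ι → ℝ) (a' - a) = 0 := by simp [omegaForm]
  subst hG
  simp only [realForm_add, realForm_sub, realForm_map_ofReal, realForm_directSum,
    realForm_halfOmega, omegaForm_self, gramExponent, e, omegaForm_joinQuad, e0, e0', e1,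
    sub_dotProduct_mulVec_sub hS]
  push_cast
  field_simp
  ring

/-- The Gram matrix of the displaced copies is positive semidefinite; removing its phases and
normalisation leaves the kernel exp(G(a, b)/ħ²) with G = Σ + i(ħ/2)Ω. Shrinking the points to the
origin extracts G itself as a derivative. -/
theorem posSemidef_cov_add_halfOmega {L : Type} {ħ : ℝ} (hħ : 0 < ħ) {μ : Quad ι → ℝ}
    {cov : Matrix (Quad ι) (Quad ι) ℝ} (hS : cov.IsSymm) {R : lp (fun _ : L => ModeSpace ι) 2}
    (hR : ∀ v : Quad ι → ℝ, inner ℂ R (amplify L (displacement ħ v) R) = Complex.exp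
        (-(((symplecticForm ι *ᵥ v) ⬝ᵥ (cov *ᵥ (symplecticForm ι *ᵥ v)) / (2 * ħ ^ 2) : ℝ) : ℂ)
          + Complex.I * ((symplecticForm ι *ᵥ v ⬝ᵥ μ / ħ : ℝ) : ℂ))) :
    (cov.map Complex.ofReal + halfOmega ħ ι).PosSemidef := by
  set G := cov.map Complex.ofReal + halfOmega ħ ι with hG
  have hGh : G.IsHermitian := (isHermitian_map_ofReal hS).add (isHermitian_halfOmega ħ)
  have hc : (ħ : ℂ) ≠ 0 := by exact_mod_cast hħ.ne'
  refine posSemidef_of_exp_entries hGh fun t ht => ?_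
  -- With the scale ħ√t the kernel entries become exp(t G_kl); `none` is the origin.
  let a : Option (Quad ι) → Quad ι → ℝ :=
    fun i => i.elim 0 fun k => (ħ * √t) • (Pi.single k 1 : Quad ι → ℝ)
  -- Since Ω² = -1, this is the solution of Ωz = a.
  let z : Option (Quad ι) → Quad ι → ℝ := fun i => -(symplecticForm ι *ᵥ a i)
  have hz : ∀ i, symplecticForm ι *ᵥ z i = a i := by
    intro i
    ext ⟨j, b⟩
    fin_cases b <;> simp [z, symplecticForm_mulVec_zero, symplecticForm_mulVec_one]
  have hgram := Matrix.posSemidef_gram ℂ fun i => amplify L (displacement ħ (z i)) R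
  let m : Option (Quad ι) → ℂ := fun i => Complex.exp (Complex.I * ((a i ⬝ᵥ μ / ħ : ℝ) : ℂ))
  have hm : ∀ i, (starRingEnd ℂ) (m i) * m i = 1 := by
    intro i
    simp only [m]
    rw [RCLike.conj_mul, mul_comm Complex.I, Complex.norm_exp_ofReal_mul_I]; simp
  let g : Option (Quad ι) → ℂ := fun i => ((1 / ħ ^ 2 : ℝ) : ℂ) * (realForm G (a i) (a i) / 2)
  have hg : ∀ i, (starRingEnd ℂ) (g i) = g i := by
    intro i
    have e : (starRingEnd ℂ) (realForm G (a i) (a i)) = realForm G (a i) (a i) := by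
      rw [hG, realForm_add, realForm_map_ofReal, realForm_halfOmega]
      simp
    simp only [g, map_mul, Complex.conj_ofReal, map_div₀, e, map_ofNat]
  refine posSemidef_of_eq_star_mul_mul hgram (fun i => (starRingEnd ℂ) (m i) * Complex.exp (g i))
    fun i j => ?_
  have hij : (t : ℂ) * (i.elim 0 fun a => j.elim 0 fun b => G a b) =
      ((1 / ħ ^ 2 : ℝ) : ℂ) * realForm G (a i) (a j) := by
    have hts : (√t : ℂ) * √t = t := by exact_mod_cast Real.mul_self_sqrt ht.le
    have hsm : ∀ (c : ℝ) (k l : Quad ι), realForm G (c • (Pi.single k 1 : Quad ι → ℝ))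
        (c • (Pi.single l 1 : Quad ι → ℝ)) = (c : ℂ) * c * G k l := by
      intro c k l
      rw [← realForm_single G k l, realForm, realForm]
      have : ∀ k : Quad ι, (fun x => (((c • (Pi.single k 1 : Quad ι → ℝ)) x : ℝ) : ℂ)) =
          (c : ℂ) • fun x => (((Pi.single k 1 : Quad ι → ℝ) x : ℝ) : ℂ) := by
        intro k; ext x; simp
      rw [this, this, smul_dotProduct, mulVec_smul, dotProduct_smul, smul_eq_mul, smul_eq_mul,
        mul_assoc]
    rcases i with _ | k
    · simp [a, realForm, dotProduct]
    rcases j with _ | l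
    · simp [a, realForm, ← Pi.zero_def]
    simp only [a, Option.elim]
    rw [hsm, ← hts]
    push_cast
    field_simp
  rw [of_apply, hij]
  change _ = _ * inner ℂ (amplify L (displacement ħ (z i)) R) (amplify L (displacement ħ (z j)) R)
  rw [inner_amplify_displacement hR, hz, hz, gramExponent_eq_realForm hħ.ne' hS, ← hG]
  have hexp : Complex.exp (((1 / ħ ^ 2 : ℝ) : ℂ) * (realForm G (a i) (a j) -
      realForm G (a i) (a i) / 2 - realForm G (a j) (a j) / 2)) =
      Complex.exp (((1 / ħ ^ 2 : ℝ) : ℂ) * realForm G (a i) (a j)) * Complex.exp (-g i) *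
        Complex.exp (-g j) := by
    rw [← Complex.exp_add, ← Complex.exp_add]; congr 1; simp only [g]; ring
  have hge : star (Complex.exp (g i)) = Complex.exp (g i) := by
    rw [Complex.star_def, ← Complex.exp_conj, hg]
  rw [hexp, star_mul', hge, Complex.exp_neg, Complex.exp_neg]
  change _ = star (star (m i)) * _ * _ * ((starRingEnd ℂ) (m i) * m j * _)
  rw [star_star]
  have h1 := Complex.exp_ne_zero (g i)
  have h2 := Complex.exp_ne_zero (g j)
  have e3 : m i * Complex.exp (g i) * ((starRingEnd ℂ) (m j) * Complex.exp (g j)) *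
      ((starRingEnd ℂ) (m i) * m j * (Complex.exp (((1 / ħ ^ 2 : ℝ) : ℂ) * realForm G (a i) (a j)) *
        (Complex.exp (g i))⁻¹ * (Complex.exp (g j))⁻¹)) =
      ((starRingEnd ℂ) (m i) * m i) * ((starRingEnd ℂ) (m j) * m j) *
        (Complex.exp (g i) * (Complex.exp (g i))⁻¹) * (Complex.exp (g j) * (Complex.exp (g j))⁻¹) *
        Complex.exp (((1 / ħ ^ 2 : ℝ) : ℂ) * realForm G (a i) (a j)) := by ring
  rw [e3, hm, hm, mul_inv_cancel₀ h1, mul_inv_cancel₀ h2]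
  ring

/-- The uncertainty relation `Σ ≥ i(ħ/2)Ω` for the covariance matrix of a Gaussian family. -/
theorem posSemidef_cov_sub_halfOmega {L : Type} {ħ : ℝ} (hħ : 0 < ħ) {μ : Quad ι → ℝ}
    {cov : Matrix (Quad ι) (Quad ι) ℝ} (hS : cov.IsSymm) {R : lp (fun _ : L => ModeSpace ι) 2}
    (hR : ∀ v : Quad ι → ℝ, inner ℂ R (amplify L (displacement ħ v) R) = Complex.exp
        (-(((symplecticForm ι *ᵥ v) ⬝ᵥ (cov *ᵥ (symplecticForm ι *ᵥ v)) / (2 * ħ ^ 2) : ℝ) : ℂ)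
          + Complex.I * ((symplecticForm ι *ᵥ v ⬝ᵥ μ / ħ : ℝ) : ℂ))) :
    (cov.map Complex.ofReal - halfOmega ħ ι).PosSemidef := by
  have h := (posSemidef_cov_add_halfOmega hħ hS hR).transpose
  have e : (cov.map Complex.ofReal)ᵀ = cov.map Complex.ofReal := by
    ext i j; simp [hS.apply]
  rwa [transpose_add, e, transpose_halfOmega, ← sub_eq_add_neg] at h

/-- The core estimate: the positive semidefinite kernel built from `hZ` compares the two
half-shifted copies of the family, at -Ωv/2 and +Ωv/2. Their overlap is ⟨B, D_v B⟩ up to a phase and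
the factor contributed by `Z`. -/
theorem norm_inner_sum_le {L I : Type} [Fintype I] {ħ : ℝ} (hħ : 0 < ħ) {μ : Quad (ι ⊕ κ) → ℝ}
    {cov : Matrix (Quad (ι ⊕ κ)) (Quad (ι ⊕ κ)) ℝ} (hS : cov.IsSymm)
    {R : lp (fun _ : L => ModeSpace (ι ⊕ κ)) 2}
    (hR : ∀ v, inner ℂ R (amplify L (displacement ħ v) R) = Complex.exp
        (-(((symplecticForm (ι ⊕ κ) *ᵥ v) ⬝ᵥ
          (cov *ᵥ (symplecticForm (ι ⊕ κ) *ᵥ v)) / (2 * ħ ^ 2) : ℝ) : ℂ)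
          + Complex.I * ((symplecticForm (ι ⊕ κ) *ᵥ v ⬝ᵥ μ / ħ : ℝ) : ℂ)))
    {Z : Matrix (Quad ι) (Quad ι) ℂ}
    (hZ : (cov.map Complex.ofReal + directSum 0 (halfOmega ħ κ) - directSum Z 0).PosSemidef)
    (v : Quad ι → ℝ) (c : I → ℂ) (w : I → Quad κ → ℝ)
    {B : lp (fun _ : L => ModeSpace (ι ⊕ κ)) 2}
    (hB : B = ∑ i, c i • amplify L (displacement ħ (joinQuad 0 (w i))) R) :
    ‖inner ℂ B (amplify L (displacement ħ (joinQuad v 0)) B)‖ ≤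
      Real.exp (-((realForm Z (symplecticForm ι *ᵥ v) (symplecticForm ι *ᵥ v)).re /
        (2 * ħ ^ 2))) * ‖B‖ ^ 2 := by
  set G := cov.map Complex.ofReal + directSum 0 (halfOmega ħ κ) - directSum Z 0 with hG
  set α := symplecticForm ι *ᵥ v with hα
  let β : I → Quad κ → ℝ := fun i => symplecticForm κ *ᵥ w i
  let p : I ⊕ I → Quad (ι ⊕ κ) → ℝ := Sum.elim (fun i => joinQuad (-(1 / 2 : ℝ) • α) (β i))
    fun i => joinQuad ((1 / 2 : ℝ) • α) (β i)
  have hsc : (0 : ℂ) ≤ ((1 / ħ ^ 2 : ℝ) : ℂ) := by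
    have : (0 : ℝ) ≤ 1 / ħ ^ 2 := by positivity
    exact_mod_cast this
  have hK := posSemidef_exp_normalized ((posSemidef_realForm hZ p).smul hsc)
  -- The coefficients absorb the phases due to the mean.
  let x : I → ℂ := fun i =>
    c i * Complex.exp (Complex.I * ((joinQuad (0 : Quad ι → ℝ) (β i) ⬝ᵥ μ / ħ : ℝ) : ℂ))
  have hs : ∀ (u : Quad ι → ℝ) (i : I), symplecticForm (ι ⊕ κ) *ᵥ joinQuad u (w i) =
      joinQuad (symplecticForm ι *ᵥ u) (β i) := fun u i => symplecticForm_mulVec_joinQuad _ _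
  have hgram : ∀ u : Quad ι → ℝ, inner ℂ B (amplify L (displacement ħ (joinQuad u 0)) B) =
      Complex.exp (Complex.I * ((joinQuad (symplecticForm ι *ᵥ u) (0 : Quad κ → ℝ) ⬝ᵥ μ / ħ : ℝ)
        : ℂ)) * ∑ i, ∑ j, star (x i) * x j *
        Complex.exp (gramExponent ħ cov (joinQuad 0 (β i))
          (joinQuad (symplecticForm ι *ᵥ u) (β j))) := by
    intro u
    have e : ∀ j, amplify L (displacement ħ (joinQuad u 0))
        (amplify L (displacement ħ (joinQuad 0 (w j))) R) =
        amplify L (displacement ħ (joinQuad u (w j))) R := by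
      intro j
      ext l : 2
      simp only [amplify_apply]
      rw [displacement_displacement]
      have h1 : weylPhase ħ (joinQuad u 0) (joinQuad 0 (w j)) = 0 := by
        simp [weylPhase, joinQuad]
      have h2 : joinQuad u (0 : Quad κ → ℝ) + joinQuad 0 (w j) = joinQuad u (w j) := by
        ext ⟨a | a, b⟩ <;> simp [joinQuad]
      rw [h1, h2]; simp
    rw [hB, map_sum, sum_inner, Finset.mul_sum]
    refine Finset.sum_congr rfl fun i _ => ?_
    rw [inner_sum, Finset.mul_sum]
    refine Finset.sum_congr rfl fun j _ => ?_
    rw [map_smul, e, inner_smul_left, inner_smul_right, inner_amplify_displacement hR, hs, hs,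
      mulVec_zero]
    have h3 : joinQuad (symplecticForm ι *ᵥ u) (β j) ⬝ᵥ μ =
        joinQuad (0 : Quad ι → ℝ) (β j) ⬝ᵥ μ +
          joinQuad (symplecticForm ι *ᵥ u) (0 : Quad κ → ℝ) ⬝ᵥ μ := by
      rw [← add_dotProduct]; congr 1
      ext ⟨a | a, b⟩ <;> simp [joinQuad]
    rw [h3, add_div, Complex.ofReal_add, mul_add, Complex.exp_add]
    simp only [x, star_mul', Complex.star_def]
    ring
  -- Within one block the common shift `s` cancels together with the `Z` terms, leaving the Gram sum
  -- of B itself.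
  have hdiag : ∀ s : Quad ι → ℝ, ∑ i, ∑ j, star (x i) * x j *
      Complex.exp (((1 / ħ ^ 2 : ℝ) : ℂ) * (realForm G (joinQuad s (β i)) (joinQuad s (β j)) -
        realForm G (joinQuad s (β i)) (joinQuad s (β i)) / 2 -
        realForm G (joinQuad s (β j)) (joinQuad s (β j)) / 2)) = ((‖B‖ ^ 2 : ℝ) : ℂ) := by
    intro s
    have h0 := hgram 0
    have e0 : joinQuad (0 : Quad ι → ℝ) (0 : Quad κ → ℝ) = 0 := by
      ext ⟨a | a, b⟩ <;> simp [joinQuad]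
    rw [mulVec_zero, e0, displacement_zero] at h0
    have e1 : amplify L (1 : ModeSpace (ι ⊕ κ) →L[ℂ] ModeSpace (ι ⊕ κ)) B = B := rfl
    rw [e1, inner_self_eq_norm_sq_to_K, zero_dotProduct, zero_div, Complex.ofReal_zero, mul_zero,
      Complex.exp_zero, one_mul] at h0
    rw [Complex.ofReal_pow]
    refine Eq.trans ?_ h0.symm
    refine Finset.sum_congr rfl fun i _ => Finset.sum_congr rfl fun j _ => ?_
    rw [gramExponent_joinQuad hħ.ne' hS Z hG, sub_self]
    congr 2
    ring
  have hoff := norm_offDiagonal_le_of_posSemidef hK x (c := ‖B‖ ^ 2)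
    (by
      rw [← hdiag (-(1 / 2 : ℝ) • α)]
      refine Finset.sum_congr rfl fun i _ => Finset.sum_congr rfl fun j _ => ?_
      simp only [of_apply, Matrix.smul_apply, smul_eq_mul, p, Sum.elim_inl]
      congr 2; ring)
    (by
      rw [← hdiag ((1 / 2 : ℝ) • α)]
      refine Finset.sum_congr rfl fun i _ => Finset.sum_congr rfl fun j _ => ?_
      simp only [of_apply, Matrix.smul_apply, smul_eq_mul, p, Sum.elim_inr]
      congr 2; ring)
  have hsm : ∀ r s : ℝ, realForm Z (r • α) (s • α) = r * s * realForm Z α α := by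
    intro r s
    have : ∀ r : ℝ, (fun y => (((r • α) y : ℝ) : ℂ)) = (r : ℂ) • fun y => ((α y : ℝ) : ℂ) := by
      intro r; ext y; simp
    simp only [realForm, this, smul_dotProduct, mulVec_smul, dotProduct_smul, smul_eq_mul]
    ring
  -- For a = -α/2 and a' = α/2 the normalised `Z` term is -1/4 - 1/8 - 1/8 = -1/2 times Z(α, α),
  -- whence the prefactor exp(Z(α, α)/(2ħ²)).
  have hoff' : ∑ i, ∑ j, star (x i) * x j * (Matrix.of fun i j => Complex.exp
      ((((1 / ħ ^ 2 : ℝ) : ℂ) • Matrix.of fun i j => realForm G (p i) (p j)) i j -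
        (((1 / ħ ^ 2 : ℝ) : ℂ) • Matrix.of fun i j => realForm G (p i) (p j)) i i / 2 -
        (((1 / ħ ^ 2 : ℝ) : ℂ) • Matrix.of fun i j => realForm G (p i) (p j)) j j / 2))
        (Sum.inl i) (Sum.inr j) =
      Complex.exp (((1 / ħ ^ 2 : ℝ) : ℂ) * (realForm Z α α / 2)) *
      ∑ i, ∑ j, star (x i) * x j *
        Complex.exp (gramExponent ħ cov (joinQuad 0 (β i)) (joinQuad α (β j))) := by
    rw [Finset.mul_sum]
    refine Finset.sum_congr rfl fun i _ => ?_
    rw [Finset.mul_sum]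
    refine Finset.sum_congr rfl fun j _ => ?_
    refine Eq.trans (congrArg (star (x i) * x j * ·) (?_ : _ =
      Complex.exp (((1 / ħ ^ 2 : ℝ) : ℂ) * (realForm Z α α / 2)) *
        Complex.exp (gramExponent ħ cov (joinQuad 0 (β i)) (joinQuad α (β j))))) (by ring)
    rw [← Complex.exp_add]
    simp only [of_apply, Matrix.smul_apply, smul_eq_mul, p, Sum.elim_inl, Sum.elim_inr]
    have h := gramExponent_joinQuad hħ.ne' hS Z hG (-(1 / 2 : ℝ) • α) ((1 / 2 : ℝ) • α) (β i) (β j)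
    rw [hsm, hsm, hsm, show (1 / 2 : ℝ) • α - -(1 / 2 : ℝ) • α = α by
      rw [← sub_smul]; norm_num] at h
    refine congrArg Complex.exp (Eq.trans ?_ (h.trans ?_))
    · ring
    · push_cast; ring
  rw [hoff', norm_mul, Complex.norm_exp] at hoff
  rw [hgram v, norm_mul, mul_comm Complex.I, Complex.norm_exp_ofReal_mul_I, one_mul, Real.exp_neg,
    ← div_eq_inv_mul, le_div_iff₀ (Real.exp_pos _), mul_comm]
  refine le_trans (le_of_eq ?_) hoff
  congr 2
  rw [Complex.re_ofReal_mul]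
  have : (realForm Z α α / 2).re = (realForm Z α α).re / 2 := by
    rw [show (2 : ℂ) = ((2 : ℝ) : ℂ) by simp, Complex.div_ofReal_re]
  rw [this]
  field_simp

end GaussianBound

/-! ### From finite sums of displaced copies to arbitrary slices -/

section SliceBound

variable {ι κ L : Type} [Fintype ι] [DecidableEq ι] [Fintype κ] [DecidableEq κ]

/-- For the slices `x_l = (1 ⊗ ⟨f|) r_l` of a Gaussian family `r`, the displacement expectation
`∑ ⟨x_l, D_v x_l⟩` is at most `exp(-(Ωv)ᵀ Z (Ωv) / (2ħ²)) ∑ ‖x_l‖²`. -/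
theorem norm_tsum_inner_slice_le {ħ : ℝ} (hħ : 0 < ħ) {μ : Quad (ι ⊕ κ) → ℝ}
    {cov : Matrix (Quad (ι ⊕ κ)) (Quad (ι ⊕ κ)) ℝ} (hS : cov.IsSymm)
    {R : lp (fun _ : L => ModeSpace (ι ⊕ κ)) 2}
    (hR : ∀ v, inner ℂ R (amplify L (displacement ħ v) R) = Complex.exp
        (-(((symplecticForm (ι ⊕ κ) *ᵥ v) ⬝ᵥ
          (cov *ᵥ (symplecticForm (ι ⊕ κ) *ᵥ v)) / (2 * ħ ^ 2) : ℝ) : ℂ)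
          + Complex.I * ((symplecticForm (ι ⊕ κ) *ᵥ v ⬝ᵥ μ / ħ : ℝ) : ℂ)))
    {Z : Matrix (Quad ι) (Quad ι) ℂ}
    (hZ : (cov.map Complex.ofReal + directSum 0 (halfOmega ħ κ) - directSum Z 0).PosSemidef)
    (v : Quad ι → ℝ) (f : ModeSpace κ) :
    ‖∑' l, inner ℂ (ContinuousLinearMap.adjoint (tensorRight ι f) (R l))
        (displacement ħ v (ContinuousLinearMap.adjoint (tensorRight ι f) (R l)))‖ ≤
      Real.exp (-((realForm Z (symplecticForm ι *ᵥ v) (symplecticForm ι *ᵥ v)).re /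
        (2 * ħ ^ 2))) *
        ∑' l, ‖ContinuousLinearMap.adjoint (tensorRight ι f) (R l)‖ ^ 2 := by
  -- Any nonzero `h` serves: it carries the slices back into the joint space as x_l ⊗ h, and ‖h‖²
  -- cancels at the end.
  obtain ⟨h, hh⟩ : ∃ h : ModeSpace κ, h ≠ 0 := by
    obtain ⟨g, hg⟩ := exists_modeSpace_ae_ne_zero κ
    refine ⟨g, fun h0 => ?_⟩
    have h1 : ∀ᵐ q : κ → ℝ, False := by
      filter_upwards [hg, (Lp.eq_zero_iff_ae_eq_zero).1 h0] with q h1 h2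
      exact h1 h2
    rw [Filter.eventually_false_iff_eq_bot, ae_eq_bot] at h1
    exact NeZero.ne _ h1
  set C := Real.exp (-((realForm Z (symplecticForm ι *ᵥ v) (symplecticForm ι *ᵥ v)).re /
    (2 * ħ ^ 2)))
  set x : L → ModeSpace ι := fun l => ContinuousLinearMap.adjoint (tensorRight ι f) (R l)
  set B := amplify L (rankOneRight ι h f) R with hB
  have hcl : IsClosed {B : lp (fun _ : L => ModeSpace (ι ⊕ κ)) 2 |
      ‖inner ℂ B (amplify L (displacement ħ (joinQuad v 0)) B)‖ ≤ C * ‖B‖ ^ 2} := by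
    refine isClosed_le (Continuous.norm ?_) (by fun_prop)
    exact continuous_id.inner (amplify L (displacement ħ (joinQuad v 0))).continuous
  -- The inequality is a closed condition valid on the span of the displaced copies, so it passes to
  -- the closure, where `B` lies.
  have hmem : ‖inner ℂ B (amplify L (displacement ħ (joinQuad v 0)) B)‖ ≤ C * ‖B‖ ^ 2 := by
    refine closure_minimal (fun y hy => ?_) hcl
      (amplify_rankOneRight_mem_closure hħ.ne' R h f)
    obtain ⟨c, rfl⟩ := Finsupp.mem_span_range_iff_exists_finsupp.1 hy
    refine norm_inner_sum_le (I := c.support) hħ hS hR hZ v (fun i => c i) (fun i => i) ?_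
    rw [Finsupp.sum, ← Finset.sum_coe_sort]
  have hinner : ∀ u : ModeSpace ι →L[ℂ] ModeSpace ι, ∀ U,
      (∀ y, U (productVector y h) = productVector (u y) h) →
      inner ℂ B (amplify L U B) = (∑' l, inner ℂ (x l) (u (x l))) * (‖h‖ ^ 2 : ℝ) := by
    intro u U hU
    rw [lp.inner_eq_tsum, ← tsum_mul_right]
    refine tsum_congr fun l => ?_
    change inner ℂ (productVector (x l) h) (U (productVector (x l) h)) = _
    rw [hU, inner_productVector, inner_self_eq_norm_sq_to_K]
    push_cast; rfl
  have h1 := hinner (displacement ħ v) (displacement ħ (joinQuad v 0)) fun y => by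
    rw [displacement_productVector, displacement_zero]; rfl
  have h2 := hinner 1 1 fun y => rfl
  have h3 : amplify L (1 : ModeSpace (ι ⊕ κ) →L[ℂ] ModeSpace (ι ⊕ κ)) B = B := rfl
  have h4 : ∑' l, inner ℂ (x l) ((1 : ModeSpace ι →L[ℂ] ModeSpace ι) (x l)) =
      ((∑' l, ‖x l‖ ^ 2 : ℝ) : ℂ) := by
    rw [Complex.ofReal_tsum]
    refine tsum_congr fun l => ?_
    rw [one_apply_eq_self, inner_self_eq_norm_sq_to_K]
    push_cast; rfl
  rw [h3, inner_self_eq_norm_sq_to_K, h4] at h2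
  have h5 : ‖B‖ ^ 2 = (∑' l, ‖x l‖ ^ 2) * ‖h‖ ^ 2 :=
    Complex.ofReal_injective (by rw [Complex.ofReal_pow, Complex.ofReal_mul]; exact h2)
  have hpos : 0 < ‖h‖ ^ 2 := by positivity
  rw [h1, h5, norm_mul, Complex.norm_real, Real.norm_of_nonneg hpos.le, ← mul_assoc] at hmem
  exact le_of_mul_le_mul_right hmem hpos

end SliceBound

/-! ### Rank-one decompositions and traces -/

section Trace

variable {H : Type} [NormedAddCommGroup H] [InnerProductSpace ℂ H]

/-- `A = ∑ |x_l⟩⟨x_l|` in the weak sense. -/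
def IsRankOneSum {L : Type} (A : H →L[ℂ] H) (x : L → H) : Prop :=
  ∀ φ ψ : H, HasSum (fun l => inner ℂ φ (x l) * inner ℂ (x l) ψ) (inner ℂ φ (A ψ))

theorem IsRankOneSum.hasSum_norm_sq {L K : Type} {A : H →L[ℂ] H} {x : L → H}
    (hx : IsRankOneSum A x) (b : HilbertBasis K ℂ H) {c : ℝ}
    (hc : HasSum (fun k => inner ℂ (b k) (A (b k))) (c : ℂ)) :
    HasSum (fun l => ‖x l‖ ^ 2) c := by
  have h : ∀ k, HasSum (fun l => ((‖inner ℂ (b k) (x l)‖ ^ 2 : ℝ) : ℂ))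
      (inner ℂ (b k) (A (b k))) := by
    intro k
    refine (hx (b k) (b k)).congr_fun fun l => ?_
    rw [← inner_conj_symm (x l), RCLike.mul_conj]; norm_cast
  have hs : ∀ k, Summable fun l => ‖inner ℂ (b k) (x l)‖ ^ 2 := fun k =>
    Complex.summable_ofReal.1 (h k).summable
  refine summable_sq_of_hasSum_tsum_norm_inner_sq b hs (Complex.hasSum_ofReal.1 ?_)
  refine hc.congr_fun fun k => ?_
  rw [Complex.ofReal_tsum, (h k).tsum_eq]

/-- Parseval for square-summable families gives the same value in every orthonormal basis, which is
what `HasTrace` demands. -/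
theorem IsRankOneSum.hasTrace_comp [CompleteSpace H] {L : Type} {A : H →L[ℂ] H} {x : L → H}
    (hx : IsRankOneSum A x) (hs : Summable fun l => ‖x l‖ ^ 2) (T : H →L[ℂ] H) :
    HasTrace (A ∘L T) (∑' l, inner ℂ (x l) (T (x l))) := by
  intro K b
  have h := hasSum_tsum_inner_mul_inner b
    (summable_sq_apply (ContinuousLinearMap.adjoint T) hs) hs
  simp only [ContinuousLinearMap.adjoint_inner_left] at h
  refine h.congr_fun fun k => ?_
  rw [ContinuousLinearMap.comp_apply, ← (hx (b k) (T (b k))).tsum_eq]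
  exact tsum_congr fun l => mul_comm _ _

theorem exists_selfAdjoint_sqrt [CompleteSpace H] {A : H →L[ℂ] H} (hA : A.IsPositive) :
    ∃ F : H →L[ℂ] H, ContinuousLinearMap.adjoint F = F ∧ ∀ x, F (F x) = A x := by
  have hA' := (ContinuousLinearMap.nonneg_iff_isPositive A).2 hA
  refine ⟨CFC.sqrt A, ?_, fun x => ?_⟩
  · have h := ((ContinuousLinearMap.nonneg_iff_isPositive _).1 (CFC.sqrt_nonneg A))
    exact h.isSelfAdjoint.adjoint_eq
  · exact DFunLike.congr_fun (CFC.sqrt_mul_sqrt_self A hA') x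

theorem exists_isRankOneSum [CompleteSpace H] {A : H →L[ℂ] H} (hA : A.IsPositive) :
    ∃ (L : Type) (x : L → H), IsRankOneSum A x := by
  obtain ⟨F, hF, hFA⟩ := exists_selfAdjoint_sqrt hA
  obtain ⟨w, c, -⟩ := exists_hilbertBasis ℂ H
  refine ⟨w, fun l => F (c l), fun φ ψ => ?_⟩
  have hsym : ∀ a b, inner ℂ a (F b) = inner ℂ (F a) b := fun a b => by
    rw [← ContinuousLinearMap.adjoint_inner_left, hF]
  rw [← hFA, hsym]
  refine (c.hasSum_inner_mul_inner (F φ) (F ψ)).congr_fun fun l => ?_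
  rw [hsym φ, hsym (c l)]

theorem HasTrace.unique {T : H →L[ℂ] H} [CompleteSpace H] {s t : ℂ} (hs : HasTrace T s)
    (ht : HasTrace T t) : s = t := by
  obtain ⟨w, c, -⟩ := exists_hilbertBasis ℂ H
  exact (hs _ c).unique (ht _ c)

/-- Square-summability makes the double series absolutely convergent, so it may be summed fibre by
fibre. Here `k` labels basis vectors of the measured modes, and the bound for each of them adds up
to the total weight p. -/
theorem norm_tsum_inner_le_of_fiberwise {L K : Type} {x : L × K → H} {p C : ℝ} (hx : HasSum (fun z => ‖x z‖ ^ 2) p)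
    (T : H →L[ℂ] H) (h : ∀ k, ‖∑' l, inner ℂ (x (l, k)) (T (x (l, k)))‖ ≤
      C * ∑' l, ‖x (l, k)‖ ^ 2) : ‖∑' z, inner ℂ (x z) (T (x z))‖ ≤ C * p := by
  have h1 : HasSum (fun z : K × L => ‖x z.swap‖ ^ 2) p :=
    (Equiv.hasSum_iff (f := fun z : L × K => ‖x z‖ ^ 2) (Equiv.prodComm K L)).2 hx
  have h2 : Summable fun z => inner ℂ (x z) (T (x z)) :=
    (summable_inner_of_summable_sq hx.summable (summable_sq_apply T hx.summable)).of_norm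
  have h3 : HasSum (fun z : K × L => inner ℂ (x z.swap) (T (x z.swap)))
      (∑' z, inner ℂ (x z) (T (x z))) :=
    (Equiv.hasSum_iff (f := fun z : L × K => inner ℂ (x z) (T (x z))) (Equiv.prodComm K L)).2
      h2.hasSum
  have h4 : HasSum (fun k => ∑' l, inner ℂ (x (l, k)) (T (x (l, k))))
      (∑' z, inner ℂ (x z) (T (x z))) :=
    h3.prod_fiberwise fun k => (h3.summable.prod_factor k).hasSum
  have h5 : HasSum (fun k => ∑' l, ‖x (l, k)‖ ^ 2) p :=
    h1.prod_fiberwise fun k => (h1.summable.prod_factor k).hasSum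
  rw [← h4.tsum_eq]
  exact tsum_of_norm_bounded (h5.mul_left C) h

end Trace

/-! ### Post-selected states as sums over slices -/

section Postselection

variable {ι κ : Type} [Fintype ι] [Fintype κ]

/-- A post-selected state is, up to normalisation, the sum of the projections on the slices
`(1 ⊗ ⟨F b_k|) r_l`, where `F` is the square root of the effect. -/
theorem isRankOneSum_postselected {L K : Type} {ρ : ModeSpace (ι ⊕ κ) →L[ℂ] ModeSpace (ι ⊕ κ)}
    {r : L → ModeSpace (ι ⊕ κ)} (hr : IsRankOneSum ρ r) (hs : Summable fun l => ‖r l‖ ^ 2)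
    {E F : ModeSpace κ →L[ℂ] ModeSpace κ} (hF : ContinuousLinearMap.adjoint F = F)
    (hFE : ∀ x, F (F x) = E x) (b : HilbertBasis K ℂ (ModeSpace κ))
    {A : ModeSpace ι →L[ℂ] ModeSpace ι}
    (hA : ∀ φ ψ, HasSum
      (fun k => inner ℂ (productVector φ (b k)) (ρ (productVector ψ (E (b k)))))
      (inner ℂ φ (A ψ))) :
    IsRankOneSum A fun z : L × K =>
      ContinuousLinearMap.adjoint (tensorRight ι (F (b z.2))) (r z.1) := by
  intro φ ψ
  have hsym : ∀ a b, inner ℂ a (F b) = inner ℂ (F a) b := fun a b => by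
    rw [← ContinuousLinearMap.adjoint_inner_left, hF]
  -- The complementary slices (⟨φ| ⊗ 1) r_l, on which E = F² acts; Parseval in the basis `b` turns
  -- the partial trace into ∑ ⟨F ξ_l(ψ), F ξ_l(φ)⟩.
  let ξ : ModeSpace ι → L → ModeSpace κ := fun φ l =>
    ContinuousLinearMap.adjoint (tensorLeft κ φ) (r l)
  have hξ : ∀ φ, Summable fun l => ‖ξ φ l‖ ^ 2 := fun φ => summable_sq_apply _ hs
  have hFξ : ∀ φ, Summable fun l => ‖F (ξ φ l)‖ ^ 2 := fun φ => summable_sq_apply _ (hξ φ)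
  have h1 := hasSum_tsum_inner_mul_inner b (summable_sq_apply E (hξ ψ)) (hξ φ)
  have h2 : inner ℂ φ (A ψ) = ∑' l, inner ℂ (F (ξ ψ l)) (F (ξ φ l)) := by
    have e : ∀ l, inner ℂ (F (ξ ψ l)) (F (ξ φ l)) = inner ℂ (E (ξ ψ l)) (ξ φ l) := by
      intro l; rw [hsym, hFE]
    simp only [e]
    refine (hA φ ψ).unique (h1.congr_fun fun k => ?_)
    rw [← (hr _ _).tsum_eq]
    refine tsum_congr fun l => ?_
    simp only [ξ]
    rw [ContinuousLinearMap.adjoint_inner_right,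
      ← hFE (ContinuousLinearMap.adjoint (tensorLeft κ ψ) (r l)), ← hsym, ← hsym, hFE,
      ContinuousLinearMap.adjoint_inner_left, mul_comm]
    rfl
  have h3 := summable_prod_inner_mul_inner b (hFξ ψ) (hFξ φ)
  have h4 := (h3.hasSum.prod_fiberwise fun l =>
    b.hasSum_inner_mul_inner (F (ξ ψ l)) (F (ξ φ l))).tsum_eq
  rw [h2, h4]
  refine h3.hasSum.congr_fun fun z => ?_
  simp only [ξ]
  rw [← hsym, hsym (b z.2), ContinuousLinearMap.adjoint_inner_right,
    ContinuousLinearMap.adjoint_inner_left, ContinuousLinearMap.adjoint_inner_left,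
    ContinuousLinearMap.adjoint_inner_right, mul_comm]
  rfl

variable [DecidableEq ι] [DecidableEq κ]

/-- Purification: the square root of ρ applied to an orthonormal basis is square-summable because ρ
has trace one, and its inner product with its displaced copy is tr(ρ D_v). -/
theorem IsGaussianState.exists_gaussian_family {ħ : ℝ} {ρ : ModeSpace ι →L[ℂ] ModeSpace ι}
    {μ : Quad ι → ℝ} {cov : Matrix (Quad ι) (Quad ι) ℝ} (hρ : IsGaussianState ħ ρ μ cov) :
    ∃ (L : Type) (R : lp (fun _ : L => ModeSpace ι) 2), IsRankOneSum ρ (fun l => R l) ∧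
      ∀ v, inner ℂ R (amplify L (displacement ħ v) R) = Complex.exp
        (-(((symplecticForm ι *ᵥ v) ⬝ᵥ (cov *ᵥ (symplecticForm ι *ᵥ v)) / (2 * ħ ^ 2) : ℝ) : ℂ)
          + Complex.I * ((symplecticForm ι *ᵥ v ⬝ᵥ μ / ħ : ℝ) : ℂ)) := by
  obtain ⟨⟨hpos, htr⟩, -, hchar⟩ := hρ
  obtain ⟨L, r, hr⟩ := exists_isRankOneSum hpos
  obtain ⟨w, c, -⟩ := exists_hilbertBasis ℂ (ModeSpace ι)
  have hs := (hr.hasSum_norm_sq c (c := 1) (by simpa using htr _ c)).summable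
  refine ⟨L, ⟨r, (memℓp_two_iff_summable_sq L).2 hs⟩, hr, fun v => ?_⟩
  rw [lp.inner_eq_tsum]
  exact (hr.hasTrace_comp hs (displacement ħ v)).unique (hchar v)

theorem exists_hasTrace_norm_le_of_posSemidef {ħ : ℝ} (hħ : 0 < ħ)
    {ρ : ModeSpace (ι ⊕ κ) →L[ℂ] ModeSpace (ι ⊕ κ)} {μ : Quad (ι ⊕ κ) → ℝ}
    {cov : Matrix (Quad (ι ⊕ κ)) (Quad (ι ⊕ κ)) ℝ} (hρ : IsGaussianState ħ ρ μ cov)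
    {Z : Matrix (Quad ι) (Quad ι) ℂ}
    (hZ : (cov.map Complex.ofReal + directSum 0 (halfOmega ħ κ) - directSum Z 0).PosSemidef)
    (v : Quad ι → ℝ) {ρ' : ModeSpace ι →L[ℂ] ModeSpace ι} (hρ' : IsPostselectedState ρ ρ') :
    ∃ t : ℂ, HasTrace (ρ' ∘L displacement ħ v) t ∧
      ‖t‖ ≤ Real.exp (-(Real.pi / 2) * sdpObjective ħ v Z) := by
  obtain ⟨L, R, hR, hgauss⟩ := hρ.exists_gaussian_family
  obtain ⟨⟨-, htr⟩, E, p, hE, -, hp, hpost⟩ := hρ'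
  obtain ⟨F, hF, hFE⟩ := exists_selfAdjoint_sqrt hE
  obtain ⟨wκ, b, -⟩ := exists_hilbertBasis ℂ (ModeSpace κ)
  obtain ⟨wι, a, -⟩ := exists_hilbertBasis ℂ (ModeSpace ι)
  have hpc : (p : ℂ) ≠ 0 := by exact_mod_cast hp.ne'
  have hsmul : ∀ ψ, ((p : ℂ) • ρ') ψ = (p : ℂ) • ρ' ψ := fun _ => rfl
  have hRs := (memℓp_two_iff_summable_sq L).1 R.2
  have hx := isRankOneSum_postselected hR hRs hF hFE b (A := (p : ℂ) • ρ') fun φ ψ => by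
    rw [hsmul, inner_smul_right]; exact hpost _ b φ ψ
  set x : L × wκ → ModeSpace ι := fun z =>
    ContinuousLinearMap.adjoint (tensorRight ι (F (b z.2))) (R z.1)
  have hxs : HasSum (fun z => ‖x z‖ ^ 2) p := hx.hasSum_norm_sq a (by
    simpa only [hsmul, inner_smul_right, mul_one] using (htr _ a).mul_left (p : ℂ))
  set τ := ∑' z, inner ℂ (x z) (displacement ħ v (x z)) with hτ
  have htrace := hx.hasTrace_comp hxs.summable (displacement ħ v)
  rw [← hτ] at htrace
  refine ⟨(p : ℂ)⁻¹ * τ, fun K c => ?_, ?_⟩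
  · refine ((htrace K c).mul_left (p : ℂ)⁻¹).congr_fun fun k => ?_
    rw [ContinuousLinearMap.comp_apply, ContinuousLinearMap.comp_apply, hsmul, inner_smul_right,
      inv_mul_cancel_left₀ hpc]
  have hobj : -(Real.pi / 2) * sdpObjective ħ v Z =
      -((realForm Z (symplecticForm ι *ᵥ v) (symplecticForm ι *ᵥ v)).re / (2 * ħ ^ 2)) := by
    have := Real.pi_ne_zero
    change -(Real.pi / 2) * (1 / (Real.pi * ħ ^ 2) *
      (realForm Z (symplecticForm ι *ᵥ v) (symplecticForm ι *ᵥ v)).re) = _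
    field_simp
  rw [hobj]
  set C := Real.exp (-((realForm Z (symplecticForm ι *ᵥ v) (symplecticForm ι *ᵥ v)).re /
    (2 * ħ ^ 2)))
  have hle : ‖τ‖ ≤ C * p := norm_tsum_inner_le_of_fiberwise hxs (displacement ħ v) fun k =>
    norm_tsum_inner_slice_le hħ hρ.2.1 hgauss hZ v (F (b k))
  rw [norm_mul, norm_inv, Complex.norm_real, Real.norm_of_nonneg hp.le, inv_mul_le_iff₀ hp,
    mul_comm]
  exact hle

end Postselection

/-! ### Existence of a maximiser -/

section Maximum

theorem isClosed_setOf_posSemidef (Q : Type) [Fintype Q] :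
    IsClosed {M : Matrix Q Q ℂ | M.PosSemidef} := by
  simp only [posSemidef_iff_dotProduct_mulVec, Set.ofPred_and, Set.ofPred_forall]
  refine (isClosed_eq (by fun_prop) continuous_id).inter (isClosed_iInter fun x => ?_)
  refine isClosed_le continuous_const ?_
  fun_prop

/-- Decompose `M` into rank-one terms and apply 2xy ≤ x² + y² to each. -/
theorem norm_apply_le_of_posSemidef {Q : Type} [Fintype Q] {M : Matrix Q Q ℂ}
    (hM : M.PosSemidef) (i j : Q) : ‖M i j‖ ≤ ((M i i).re + (M j j).re) / 2 := by
  obtain ⟨m, A, rfl⟩ := posSemidef_iff_eq_sum_vecMulVec.1 hM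
  have hd : ∀ i, ((∑ k, vecMulVec (A k) (star (A k))) i i).re = ∑ k, ‖A k i‖ ^ 2 := by
    intro i
    rw [Matrix.sum_apply, Complex.re_sum]
    refine Finset.sum_congr rfl fun k _ => ?_
    rw [vecMulVec_apply, Pi.star_apply, Complex.star_def, Complex.mul_conj, Complex.ofReal_re,
      Complex.normSq_eq_norm_sq]
  rw [hd, hd, ← Finset.sum_add_distrib, Finset.sum_div, Matrix.sum_apply]
  refine (norm_sum_le _ _).trans (Finset.sum_le_sum fun k _ => ?_)
  rw [vecMulVec_apply, norm_mul, Pi.star_apply, norm_star]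
  linarith [two_mul_le_add_sq ‖A k i‖ ‖A k j‖]

theorem halfOmega_apply_self {ι : Type} [DecidableEq ι] (ħ : ℝ) (i : Quad ι) : halfOmega ħ ι i i = 0 := by
  obtain ⟨i, b⟩ := i
  fin_cases b <;> simp [halfOmega, symplecticForm]

theorem directSum_halfOmega {ι κ : Type} [DecidableEq ι] [DecidableEq κ] (ħ : ℝ) :
    directSum (0 : Matrix (Quad ι) (Quad ι) ℂ) (halfOmega ħ κ) + directSum (halfOmega ħ ι) 0 =
      halfOmega ħ (ι ⊕ κ) := by
  ext ⟨i | i, a⟩ ⟨j | j, b⟩ <;>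
    simp [directSum, halfOmega, symplecticForm, Equiv.sumProdDistrib, Matrix.one_apply]

variable {ι κ : Type} [Fintype ι] [DecidableEq ι] [Fintype κ] [DecidableEq κ]

/-- The first constraint makes Z - i(ħ/2)Ω positive semidefinite, so its diagonal controls all its
entries. That diagonal is the diagonal of Z, as Ω has zero diagonal, and the second constraint
bounds it by the diagonal of Σ. -/
theorem isCompact_setOf_sdpFeasible (ħ ε : ℝ)
    (cov : Matrix (Quad (ι ⊕ κ)) (Quad (ι ⊕ κ)) ℝ) :
    IsCompact {Z : Matrix (Quad ι) (Quad ι) ℂ | SDPFeasible ħ ε cov Z} := by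
  have hcl : IsClosed {Z : Matrix (Quad ι) (Quad ι) ℂ | SDPFeasible ħ ε cov Z} := by
    refine (isClosed_eq (by fun_prop) continuous_id).inter (IsClosed.inter ?_ ?_)
    · exact (isClosed_setOf_posSemidef _).preimage (continuous_id.sub continuous_const)
    · refine (isClosed_setOf_posSemidef _).preimage (continuous_const.sub ?_)
      exact (continuous_id.matrix_fromBlocks continuous_const continuous_const
        continuous_const).matrix_submatrix _ _
  let s : Quad ι → ℝ := fun i => cov (Sum.inl i.1, i.2) (Sum.inl i.1, i.2)
  refine IsCompact.of_isClosed_subset (isCompact_univ_pi fun i : Quad ι => isCompact_univ_pi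
    fun j : Quad ι => isCompact_closedBall (0 : ℂ) ((s i + s j) / 2 + ‖halfOmega ħ ι i j‖)) hcl ?_
  rintro Z ⟨-, h1, h2⟩ i - j -
  have hd : ∀ i, ((Z - halfOmega ħ ι) i i).re ≤ s i := by
    intro i
    have h := h2.diag_nonneg (i := (Sum.inl i.1, i.2))
    have e : (cov.map Complex.ofReal - directSum 0 ((ε : ℂ) • halfOmega ħ κ) -
        directSum Z 0 : Matrix (Quad (ι ⊕ κ)) (Quad (ι ⊕ κ)) ℂ) (Sum.inl i.1, i.2) (Sum.inl i.1, i.2) = (s i : ℂ) - Z i i := by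
      simp [directSum, s, Equiv.sumProdDistrib]
    rw [e, Complex.nonneg_iff] at h
    rw [Matrix.sub_apply, halfOmega_apply_self, sub_zero]
    simpa using h.1
  rw [mem_closedBall_zero_iff]
  have hn := norm_apply_le_of_posSemidef h1 i j
  have hz : Z i j = (Z - halfOmega ħ ι) i j + halfOmega ħ ι i j := by simp
  rw [hz]
  refine (norm_add_le _ _).trans (add_le_add_left (hn.trans ?_) _)
  linarith [hd i, hd j]

theorem continuous_sdpObjective (ħ : ℝ) (v : Quad ι → ℝ) : Continuous (sdpObjective ħ v) := by
  unfold sdpObjective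
  fun_prop

end Maximum

/-! ### Feasible points and the effect of transposition on the program -/

section Program

variable {ι κ : Type}

theorem directSum_transpose (A : Matrix (Quad ι) (Quad ι) ℂ) (B : Matrix (Quad κ) (Quad κ) ℂ) :
    (directSum A B)ᵀ = directSum Aᵀ Bᵀ := by
  simp [directSum, transpose_submatrix, fromBlocks_transpose]

theorem directSum_zero_neg (B : Matrix (Quad κ) (Quad κ) ℂ) :
    directSum (0 : Matrix (Quad ι) (Quad ι) ℂ) (-B) = -directSum 0 B := by
  ext ⟨i | i, a⟩ ⟨j | j, b⟩ <;> simp [directSum, Equiv.sumProdDistrib]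

variable [DecidableEq ι] [DecidableEq κ]

/-- At this Z the first constraint is an equality and the second is exactly the uncertainty relation
of the joint system. -/
theorem sdpFeasible_halfOmega {ħ : ℝ} {cov : Matrix (Quad (ι ⊕ κ)) (Quad (ι ⊕ κ)) ℝ}
    (h : (cov.map Complex.ofReal - halfOmega ħ (ι ⊕ κ)).PosSemidef) :
    SDPFeasible ħ 1 cov (halfOmega ħ ι) := by
  refine ⟨isHermitian_halfOmega ħ, by rw [sub_self]; exact .zero, ?_⟩
  rwa [Complex.ofReal_one, one_smul, sub_sub, directSum_halfOmega]

theorem SDPFeasible.posSemidef_neg {ħ : ℝ} {cov : Matrix (Quad (ι ⊕ κ)) (Quad (ι ⊕ κ)) ℝ}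
    {Z : Matrix (Quad ι) (Quad ι) ℂ} (hZ : SDPFeasible ħ (-1) cov Z) :
    (cov.map Complex.ofReal + directSum 0 (halfOmega ħ κ) - directSum Z 0).PosSemidef := by
  have h := hZ.2.2
  rwa [Complex.ofReal_neg, Complex.ofReal_one, neg_one_smul, directSum_zero_neg,
    sub_neg_eq_add] at h

/-- Σ is symmetric and iΩ antisymmetric, so transposing the second constraint reverses the sign in
front of Ω_n, as the kernel estimate requires. -/
theorem SDPFeasible.posSemidef_transpose {ħ : ℝ}
    {cov : Matrix (Quad (ι ⊕ κ)) (Quad (ι ⊕ κ)) ℝ} (hS : cov.IsSymm)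
    {Z : Matrix (Quad ι) (Quad ι) ℂ} (hZ : SDPFeasible ħ 1 cov Z) :
    (cov.map Complex.ofReal + directSum 0 (halfOmega ħ κ) - directSum Zᵀ 0).PosSemidef := by
  have h := hZ.2.2.transpose
  have e : (cov.map Complex.ofReal)ᵀ = cov.map Complex.ofReal := by
    ext i j; simp [hS.apply]
  rwa [transpose_sub, transpose_sub, directSum_transpose, directSum_transpose, transpose_zero,
    transpose_zero, e, Complex.ofReal_one, one_smul, transpose_halfOmega, directSum_zero_neg,
    sub_neg_eq_add] at h

theorem sdpObjective_transpose [Fintype ι] (ħ : ℝ) (v : Quad ι → ℝ) (Z : Matrix (Quad ι) (Quad ι) ℂ) :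
    sdpObjective ħ v Zᵀ = sdpObjective ħ v Z := by
  unfold sdpObjective
  rw [mulVec_transpose, dotProduct_comm, ← dotProduct_mulVec]

end Program

end BosonicModes

end

theorem mainTheorem12 (m n : ℕ) (ħ : ℝ) (hħ : 0 < ħ)
    (ρ : ModeSpace (Fin m ⊕ Fin n) →L[ℂ] ModeSpace (Fin m ⊕ Fin n))
    (μ : Quad (Fin m ⊕ Fin n) → ℝ)
    (cov : Matrix (Quad (Fin m ⊕ Fin n)) (Quad (Fin m ⊕ Fin n)) ℝ)
    (hρ : IsGaussianState ħ ρ μ cov) (v : Quad (Fin m) → ℝ) :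
    (∃ s : ℝ, IsGreatest (sdpObjective ħ v '' {Z | SDPFeasible ħ 1 cov Z}) s ∧
      ∀ ρ' : ModeSpace (Fin m) →L[ℂ] ModeSpace (Fin m), IsPostselectedState ρ ρ' →
        ∃ t : ℂ, HasTrace (ρ' ∘L displacement ħ v) t ∧ ‖t‖ ≤ Real.exp (-(Real.pi / 2) * s)) ∧
    (∀ Z : Matrix (Quad (Fin m)) (Quad (Fin m)) ℂ, SDPFeasible ħ (-1) cov Z →
      ∀ ρ' : ModeSpace (Fin m) →L[ℂ] ModeSpace (Fin m), IsPostselectedState ρ ρ' →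
        ∃ t : ℂ, HasTrace (ρ' ∘L displacement ħ v) t ∧
          ‖t‖ ≤ Real.exp (-(Real.pi / 2) * sdpObjective ħ v Z)) := by
  obtain ⟨L, R, -, hR⟩ := hρ.exists_gaussian_family
  refine ⟨?_, fun Z hZ ρ' hρ' =>
    exists_hasTrace_norm_le_of_posSemidef hħ hρ hZ.posSemidef_neg v hρ'⟩
  obtain ⟨s, hs⟩ := ((isCompact_setOf_sdpFeasible ħ 1 cov).image
    (continuous_sdpObjective ħ v)).exists_isGreatest
    ⟨_, _, sdpFeasible_halfOmega (posSemidef_cov_sub_halfOmega hħ hρ.2.1 hR), rfl⟩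
  refine ⟨s, hs, fun ρ' hρ' => ?_⟩
  obtain ⟨Z, hZ, rfl⟩ := hs.1
  -- The kernel estimate is applied to the transpose of the optimal Z, which has the same objective
  -- value because Ωv is real.
  rw [← sdpObjective_transpose]
  exact exists_hasTrace_norm_le_of_posSemidef hħ hρ (hZ.posSemidef_transpose hρ.2.1) v hρ'
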